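/- Let $\mathbb{K}$ be a field and $n\ge 0$ an integer. Let $I_{L_n}$ be the Plücker ideal, that is, the kernel of the $\mathbb{K}$-algebra homomorphism $\mathbb{K}[p_{ij}:1\le i<j\le n]\to\mathbb{K}[x_1,\dots,x_n,y_1,\dots,y_n]$, $p_{ij}\mapsto x_iy_j-x_jy_i$. Order monomials lexicographically with $p_{12}>p_{13}>\dots>p_{1n}>p_{23}>\dots>p_{2n}>\dots>p_{n-1,n}$, and consider \[ \begin{aligned} Q_{ijkl}&:=\underline{p_{ij}p_{kl}}-p_{ik}p_{jl}+p_{il}p_{jk}, && i<j<k<l,\\ C^{(5)}_{ijklm}&:=\underline{p_{ik}p_{jl}p_{km}}-p_{ik}p_{jm}p_{kl}-p_{il}p_{jk}p_{km}+p_{im}p_{jk}p_{kl}, && i<j<k<l<m,\\ C^{(6)}_{ijklms}&:=\underline{p_{il}p_{jm}p_{ks}}-p_{il}p_{js}p_{km}-p_{im}p_{jk}p_{ls}+p_{is}p_{jk}p_{lm}, && i<j<k<l<m<s. \end{aligned} \] (a) The polynomials $Q_{ijkl}$, $C^{(5)}_{ijklm}$, $C^{(6)}_{ijklms}$ are pairwise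 distinct, so they are $\binom n4$ quadrics and $\binom n5+\binom n6$ cubics; their leading terms are the underlined monomials; and they form a minimal Gröbner basis of $I_{L_n}$: a Gröbner basis with leading coefficients $1$ in which no leading monomial divides the leading monomial of another element. (b) Replace every $C^{(6)}_{ijklms}$ by \[ \begin{aligned} \widetilde C^{(6)}_{ijklms}:={}&C^{(6)}_{ijklms}+p_{im}Q_{jkls}-p_{is}Q_{jklm}\\ ={}&\underline{p_{il}p_{jm}p_{ks}}-p_{il}p_{js}p_{km}-p_{im}p_{jl}p_{ks}+p_{im}p_{js}p_{kl}+p_{is}p_{jl}p_{km}-p_{is}p_{jm}p_{kl}, \end{aligned} \] which has the same leading term. Then the $\binom n4$ quadrics $Q_{ijkl}$ and the $\binom n5+\binom n6$ cubics $C^{(5)}_{ijklm}$, $\widetilde C^{(6)}_{ijklms}$ (again pairwise distinct) form the reduced Gröbner basis of $I_{L_n}$: a Gröbner basis with leading coefficients $1$ in which no monomial occurring in an element is divisible by the leading monomial of another element. -/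

import Mathlib

namespace GroebnerBasis

open MvPolynomial

variable {σ K : Type*} [Field K]

/-- `G` is a Gröbner basis of the ideal `I` for the monomial order `m`: a finite set of nonzero
elements of `I` whose leading terms generate the initial ideal (the ideal generated by the leading
terms of all elements of `I`). -/
def IsGroebnerBasis (m : MonomialOrder σ) (I : Ideal (MvPolynomial σ K))
    (G : Set (MvPolynomial σ K)) : Prop :=
  G.Finite ∧ G ⊆ I ∧ (∀ g ∈ G, g ≠ 0) ∧
    Ideal.span (m.leadingTerm '' (I : Set (MvPolynomial σ K))) = Ideal.span (m.leadingTerm '' G)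

/-- A Gröbner basis is minimal if its elements have leading coefficient `1` and the leading
monomial of an element is never divisible by the leading monomial of another one.
Divisibility of monomials is the componentwise order on exponents. -/
def IsMinimalGroebnerBasis (m : MonomialOrder σ) (I : Ideal (MvPolynomial σ K))
    (G : Set (MvPolynomial σ K)) : Prop :=
  IsGroebnerBasis m I G ∧ (∀ g ∈ G, m.leadingCoeff g = 1) ∧
    ∀ g ∈ G, ∀ h ∈ G, h ≠ g → ¬ m.degree h ≤ m.degree g

/-- A Gröbner basis is reduced if its elements have leading coefficient `1` and no monomial
occurring in an element is divisible by the leading monomial of another one. -/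
def IsReducedGroebnerBasis (m : MonomialOrder σ) (I : Ideal (MvPolynomial σ K))
    (G : Set (MvPolynomial σ K)) : Prop :=
  IsGroebnerBasis m I G ∧ (∀ g ∈ G, m.leadingCoeff g = 1) ∧
    ∀ g ∈ G, ∀ h ∈ G, h ≠ g → ∀ d ∈ g.support, ¬ m.degree h ≤ d

end GroebnerBasis

namespace Plucker

open MvPolynomial

/-- The pairs `i < j`, ordered lexicographically. The smaller a pair, the larger the corresponding
variable for `MonomialOrder.lex`, so that `p₁₂ > p₁₃ > ⋯ > p₁ₙ > p₂₃ > ⋯ > pₙ₋₁,ₙ`. -/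
abbrev Index (n : ℕ) : Type :=
  {e : Fin n ×ₗ Fin n // (ofLex e).1 < (ofLex e).2}

/-- The lexicographic order on monomials in the Plücker variables. -/
noncomputable def lexOrder (n : ℕ) : MonomialOrder (Index n) := MonomialOrder.lex

variable (K : Type*) [Field K] {n : ℕ}

/-- The Plücker ideal: the kernel of `p_{ij} ↦ x_i y_j - x_j y_i`, where `x_i` is `X (Sum.inl i)`
and `y_i` is `X (Sum.inr i)`. -/
noncomputable def pluckerIdeal (n : ℕ) : Ideal (MvPolynomial (Index n) K) :=
  RingHom.ker (aeval (R := K) fun e : Index n =>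
    (X (Sum.inl (ofLex e.1).1) * X (Sum.inr (ofLex e.1).2)
      - X (Sum.inl (ofLex e.1).2) * X (Sum.inr (ofLex e.1).1) :
        MvPolynomial (Fin n ⊕ Fin n) K))

/-- The Plücker variable `p_{ij}`; it is only used for `i < j`. -/
noncomputable def p (i j : Fin n) : MvPolynomial (Index n) K :=
  if h : i < j then X ⟨toLex (i, j), h⟩ else 0

noncomputable def quadric (i j k l : Fin n) : MvPolynomial (Index n) K :=
  p K i j * p K k l - p K i k * p K j l + p K i l * p K j k

noncomputable def cubic5 (i j k l m : Fin n) : MvPolynomial (Index n) K :=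
  p K i k * p K j l * p K k m - p K i k * p K j m * p K k l
    - p K i l * p K j k * p K k m + p K i m * p K j k * p K k l

noncomputable def cubic6 (i j k l m s : Fin n) : MvPolynomial (Index n) K :=
  p K i l * p K j m * p K k s - p K i l * p K j s * p K k m
    - p K i m * p K j k * p K l s + p K i s * p K j k * p K l m

/-- The six-index cubic after replacing `p_{jk} p_{ls}` and `p_{jk} p_{lm}` in its last two terms
by means of the quadrics with indices `jkls` and `jklm`. -/
noncomputable def cubic6' (i j k l m s : Fin n) : MvPolynomial (Index n) K :=
  p K i l * p K j m * p K k s - p K i l * p K j s * p K k m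
    - p K i m * p K j l * p K k s + p K i m * p K j s * p K k l
    + p K i s * p K j l * p K k m - p K i s * p K j m * p K k l

variable (n)

def quadrics : Set (MvPolynomial (Index n) K) :=
  {f | ∃ i j k l : Fin n, i < j ∧ j < k ∧ k < l ∧ f = quadric K i j k l}

def cubics5 : Set (MvPolynomial (Index n) K) :=
  {f | ∃ i j k l m : Fin n, i < j ∧ j < k ∧ k < l ∧ l < m ∧ f = cubic5 K i j k l m}

def cubics6 : Set (MvPolynomial (Index n) K) :=
  {f | ∃ i j k l m s : Fin n,
    i < j ∧ j < k ∧ k < l ∧ l < m ∧ m < s ∧ f = cubic6 K i j k l m s}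

def cubics6' : Set (MvPolynomial (Index n) K) :=
  {f | ∃ i j k l m s : Fin n,
    i < j ∧ j < k ∧ k < l ∧ l < m ∧ m < s ∧ f = cubic6' K i j k l m s}

end Plucker

/-! Call a monomial standard if no listed leading monomial divides it. In terms of pairs: every left
end is at most every right end (this excludes the quadrics), and no three pairs increase strictly in
both ends (this excludes the cubics, the two kinds being told apart by whether the last left end
equals the first right end or is smaller). Since all generators lie in the ideal, the Gröbner
property follows once standard monomials are linearly independent modulo it
(`eq_zero_of_isStandard`): the remainder of an ideal element on division by the generators must then
vanish. For independence, let `d` be the largest monomial of a combination `f` of standard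
monomials. As there are no chains of length three, `d` is a product of two coprime chain-free
monomials `a` and `b` (`IsStandard.exists_split`). Expand the minors and choose `x_i y_j` for the
pairs in `a` and `x_j y_i` for those in `b`; this gives a monomial `w`. It arises in only one way
from `d`, with coefficient `±1`, and every standard monomial that produces `w` is at least `d`. So
`w` survives in the image of `f`. Both claims are statements about integer matrices
(`toLex_add_le_and_eq`). A chain-free matrix is lexicographically minimal for its marginals
(`NoChain.toLex_le`). Absence of separated pairs makes the row sums of the total matrix depend only
on the row-plus-column sums (`NoSeparation.rowSum_eq`); the remaining mismatch between the two
summands is repaired by diagonal matrices, which cancel when the summands are added. -/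

namespace Plucker

/-! ### Extremality of chain-free integer matrices with given marginals. -/

section Matrices

open Finset

variable {n : ℕ}

/-- The sum of the entries in row `i`. -/
def rowSum (A : Fin n ×ₗ Fin n → ℤ) (i : Fin n) : ℤ := ∑ j, A (toLex (i, j))

/-- The sum of the entries in column `j`. -/
def colSum (A : Fin n ×ₗ Fin n → ℤ) (j : Fin n) : ℤ := ∑ i, A (toLex (i, j))

/-- No two nonzero entries are in strictly increasing position. -/
def NoChain (A : Fin n ×ₗ Fin n → ℤ) : Prop :=
  ∀ i j k l, A (toLex (i, j)) ≠ 0 → A (toLex (k, l)) ≠ 0 → i < k → ¬ j < l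

/-- Every nonzero row index is at most every nonzero column index. -/
def NoSeparation (A : Fin n ×ₗ Fin n → ℤ) : Prop :=
  ∀ i j k l, A (toLex (i, j)) ≠ 0 → A (toLex (k, l)) ≠ 0 → i ≤ l

/-- The diagonal matrix with the given diagonal. -/
def diag (d : Fin n → ℤ) : Fin n ×ₗ Fin n → ℤ := fun e => if (ofLex e).1 = (ofLex e).2 then d (ofLex e).1 else 0

theorem diag_apply (d : Fin n → ℤ) (i j : Fin n) : diag d (toLex (i, j)) = if i = j then d i else 0 := rfl

theorem rowSum_add (A B : Fin n ×ₗ Fin n → ℤ) (i : Fin n) : rowSum (A + B) i = rowSum A i + rowSum B i := by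
  simp [rowSum, sum_add_distrib]

theorem colSum_add (A B : Fin n ×ₗ Fin n → ℤ) (i : Fin n) : colSum (A + B) i = colSum A i + colSum B i := by
  simp [colSum, sum_add_distrib]

theorem rowSum_diag (d : Fin n → ℤ) (i : Fin n) : rowSum (diag d) i = d i := by
  simp [rowSum, diag_apply]

theorem colSum_diag (d : Fin n → ℤ) (i : Fin n) : colSum (diag d) i = d i := by
  simp [colSum, diag_apply]

theorem exists_of_rowSum_ne_zero {A : Fin n ×ₗ Fin n → ℤ} {i : Fin n} (h : rowSum A i ≠ 0) :
    ∃ j, A (toLex (i, j)) ≠ 0 := by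
  obtain ⟨j, -, hj⟩ := exists_ne_zero_of_sum_ne_zero h
  exact ⟨j, hj⟩

theorem exists_of_colSum_ne_zero {A : Fin n ×ₗ Fin n → ℤ} {j : Fin n} (h : colSum A j ≠ 0) :
    ∃ i, A (toLex (i, j)) ≠ 0 := by
  obtain ⟨i, -, hi⟩ := exists_ne_zero_of_sum_ne_zero h
  exact ⟨i, hi⟩

theorem rowSum_nonneg {A : Fin n ×ₗ Fin n → ℤ} (hA : 0 ≤ A) (i : Fin n) : 0 ≤ rowSum A i :=
  sum_nonneg fun _ _ => hA _

theorem colSum_nonneg {A : Fin n ×ₗ Fin n → ℤ} (hA : 0 ≤ A) (i : Fin n) : 0 ≤ colSum A i :=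
  sum_nonneg fun _ _ => hA _

/-- If all row and column sums vanish, then the first nonzero entry equals the sum of the entries
strictly below and to the right of it. -/
theorem sum_southeast_eq {D : Fin n ×ₗ Fin n → ℤ} (hrow : ∀ i, rowSum D i = 0) (hcol : ∀ j, colSum D j = 0)
    (i j : Fin n) (h : ∀ e < toLex (i, j), D e = 0) :
    ∑ k with i < k, ∑ l with j < l, D (toLex (k, l)) = D (toLex (i, j)) := by
  -- Complementing the column range and then the row range changes the sign twice and leaves the
  -- rectangle `k ≤ i`, `l ≤ j`; all its positions except the corner precede `(i, j)`
  -- lexicographically.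
  have h1 : ∀ k, ∑ l with j < l, D (toLex (k, l)) = - ∑ l with ¬ j < l, D (toLex (k, l)) := by
    intro k
    have := hrow k
    rw [rowSum, ← sum_filter_add_sum_filter_not univ (fun l => j < l)] at this
    linarith
  have h2 : ∀ l, ∑ k with i < k, D (toLex (k, l)) = - ∑ k with ¬ i < k, D (toLex (k, l)) := by
    intro l
    have := hcol l
    rw [colSum, ← sum_filter_add_sum_filter_not univ (fun k => i < k)] at this
    linarith
  simp_rw [h1]
  rw [sum_neg_distrib, sum_comm]
  simp_rw [h2]
  rw [sum_neg_distrib, neg_neg]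
  rw [sum_eq_single_of_mem j (by simp), sum_eq_single_of_mem i (by simp)]
  · intro k hk hki
    refine h _ (Prod.Lex.toLex_lt_toLex.2 (Or.inl ?_))
    simp only [mem_filter, mem_univ, true_and, not_lt] at hk
    exact lt_of_le_of_ne hk hki
  · intro l hl hlj
    refine sum_eq_zero fun k hk => h _ (Prod.Lex.toLex_lt_toLex.2 ?_)
    simp only [mem_filter, mem_univ, true_and, not_lt] at hk hl
    rcases hk.lt_or_eq with hk | hk
    · exact Or.inl hk
    · exact Or.inr ⟨hk, lt_of_le_of_ne hl hlj⟩

/-- A nonnegative matrix without strictly increasing pairs is lexicographically the smallest one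
with its row and column sums. -/
theorem NoChain.toLex_le {A B : Fin n ×ₗ Fin n → ℤ} (hA : NoChain A) (hB : 0 ≤ B)
    (hrow : ∀ i, rowSum A i = rowSum B i) (hcol : ∀ j, colSum A j = colSum B j) :
    toLex A ≤ toLex B := by
  by_contra hlt
  obtain ⟨e, he, hBA⟩ := not_le.1 hlt
  obtain ⟨⟨i, j⟩, rfl⟩ := toLex.surjective e
  simp only [Pi.toLex_apply] at he hBA
  -- If `B` were smaller, the first nonzero entry of `A - B` would be positive, hence so would some
  -- entry strictly southeast of it. Since `B ≥ 0`, the matrix `A` is nonzero at both places, which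
  -- is a chain.
  have key := sum_southeast_eq (D := A + -B)
    (fun i => by rw [rowSum_add, hrow]; simp [rowSum]) (fun i => by rw [colSum_add, hcol]; simp [colSum])
    i j (fun e h => by simp [he e h])
  have hpos : 0 < ∑ k with i < k, ∑ l with j < l, (A + -B) (toLex (k, l)) := by
    rw [key]; simp only [Pi.add_apply, Pi.neg_apply]; linarith
  obtain ⟨k, hk, hk0⟩ := exists_lt_of_sum_lt (by simpa using hpos :
    ∑ k with i < k, (0 : ℤ) < ∑ k with i < k, ∑ l with j < l, (A + -B) (toLex (k, l)))
  obtain ⟨l, hl, hl0⟩ := exists_lt_of_sum_lt (by simpa using hk0 :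
    ∑ l with j < l, (0 : ℤ) < ∑ l with j < l, (A + -B) (toLex (k, l)))
  simp only [Pi.add_apply, Pi.neg_apply, mem_filter, mem_univ, true_and] at hk hl hl0
  have hBkl : 0 ≤ B (toLex (k, l)) := hB _
  have hBij : 0 ≤ B (toLex (i, j)) := hB _
  exact hA i j k l (by linarith) (by linarith) hk hl

/-- Without separation the row indices form the lower half of the multiset of all indices and the
column indices the upper half, so this multiset determines the row sums. -/
theorem NoSeparation.rowSum_eq {M N : Fin n ×ₗ Fin n → ℤ} (hM : NoSeparation M) (hN : NoSeparation N)
    (hM0 : 0 ≤ M) (hN0 : 0 ≤ N)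
    (h : ∀ i, rowSum M i + colSum M i = rowSum N i + colSum N i) (i : Fin n) :
    rowSum M i = rowSum N i := by
  have htot : ∑ i, rowSum M i = ∑ i, rowSum N i := by
    have h1 : ∀ A : Fin n ×ₗ Fin n → ℤ, ∑ i, colSum A i = ∑ i, rowSum A i := fun A => sum_comm
    have h2 := Finset.sum_congr (rfl : (univ : Finset (Fin n)) = univ) fun i _ => h i
    rw [sum_add_distrib, sum_add_distrib, h1, h1] at h2
    linarith
  -- Here `a` is a row and `b` a column index of `M`, giving `a ≤ b`; in `N` the roles are
  -- exchanged, giving `b ≤ a`. Equality of the totals supplies such a pair from any discrepancy.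
  have aux : ∀ a b, rowSum N a < rowSum M a → rowSum M b < rowSum N b → False := by
    intro a b ha hb
    have := rowSum_nonneg hN0 a
    have := rowSum_nonneg hM0 b
    have := colSum_nonneg hN0 b
    have := colSum_nonneg hM0 a
    have := h a
    have := h b
    obtain ⟨j, hj⟩ := exists_of_rowSum_ne_zero (A := M) (i := a) (by linarith)
    obtain ⟨k, hk⟩ := exists_of_colSum_ne_zero (A := M) (j := b) (by linarith)
    obtain ⟨j', hj'⟩ := exists_of_rowSum_ne_zero (A := N) (i := b) (by linarith)
    obtain ⟨k', hk'⟩ := exists_of_colSum_ne_zero (A := N) (j := a) (by linarith)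
    have hab : a = b := le_antisymm (hM _ _ _ _ hj hk) (hN _ _ _ _ hj' hk')
    subst hab
    linarith
  by_contra hne
  rcases lt_or_gt_of_ne hne with hlt | hlt
  · obtain ⟨a, ha⟩ : ∃ a, rowSum N a < rowSum M a := by
      by_contra! hle
      exact (sum_lt_sum (fun a _ => hle a) ⟨i, mem_univ i, hlt⟩).ne htot
    exact aux a i ha hlt
  · obtain ⟨a, ha⟩ : ∃ a, rowSum M a < rowSum N a := by
      by_contra! hle
      exact (sum_lt_sum (fun a _ => hle a) ⟨i, mem_univ i, hlt⟩).ne htot.symm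
    exact aux i a hlt ha

theorem diag_nonneg {d : Fin n → ℤ} (hd : 0 ≤ d) : 0 ≤ diag d := by
  intro e
  unfold diag
  split_ifs
  · exact hd _
  · exact le_rfl

/-- Adding a diagonal matrix supported on indices that separate row from column indices creates
no strictly increasing pair. -/
theorem NoChain.add_diag {A N : Fin n ×ₗ Fin n → ℤ} (hA : NoChain A) (hN : NoSeparation N)
    (hAN : ∀ e, A e ≠ 0 → N e ≠ 0) {d : Fin n → ℤ}
    (hd : ∀ c, d c ≠ 0 → rowSum N c ≠ 0 ∧ colSum N c ≠ 0) : NoChain (A + diag d) := by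
  -- An index `c` that is both a row and a column index of `N` lies weakly between the two indices
  -- of every entry, so `(c, c)` is never strictly comparable with `(i, j)` in both coordinates.
  have hle : ∀ i j c, A (toLex (i, j)) ≠ 0 → d c ≠ 0 → i ≤ c ∧ c ≤ j := by
    intro i j c h hc
    obtain ⟨l, hl⟩ := exists_of_rowSum_ne_zero (hd c hc).1
    obtain ⟨k, hk⟩ := exists_of_colSum_ne_zero (hd c hc).2
    exact ⟨hN _ _ _ _ (hAN _ h) hk, hN _ _ _ _ hl (hAN _ h)⟩
  have hcc : ∀ b c, d b ≠ 0 → d c ≠ 0 → b ≤ c := by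
    intro b c hb hc
    obtain ⟨l, hl⟩ := exists_of_rowSum_ne_zero (hd b hb).1
    obtain ⟨k, hk⟩ := exists_of_colSum_ne_zero (hd c hc).2
    exact hN _ _ _ _ hl hk
  have hsplit : ∀ i j, (A + diag d) (toLex (i, j)) ≠ 0 →
      A (toLex (i, j)) ≠ 0 ∨ (i = j ∧ d i ≠ 0) := by
    intro i j h
    by_contra! hcon
    apply h
    rw [Pi.add_apply, hcon.1, diag_apply, zero_add]
    split_ifs with hij
    · exact hcon.2 hij
    · rfl
  intro i j k l h h' hik hjl
  rcases hsplit i j h with h1 | ⟨rfl, h1⟩ <;> rcases hsplit k l h' with h2 | ⟨rfl, h2⟩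
  · exact hA _ _ _ _ h1 h2 hik hjl
  · exact absurd hjl (hle _ _ _ h1 h2).2.not_gt
  · exact absurd hik (hle _ _ _ h2 h1).1.not_gt
  · exact absurd hik (hcc _ _ h2 h1).not_gt

/-- Let `n₁` and `n₂` have no strictly increasing pairs. Among all sums `m₁ + m₂` without separated
pairs such that `(m₁, m₂)` has the mixed marginals of `(n₁, n₂)`, the sum `n₁ + n₂` is
lexicographically the smallest, and it determines the first summand. -/
theorem toLex_add_le_and_eq {m₁ m₂ n₁ n₂ : Fin n ×ₗ Fin n → ℤ}
    (hm₁ : 0 ≤ m₁) (hm₂ : 0 ≤ m₂) (hn₁ : 0 ≤ n₁) (hn₂ : 0 ≤ n₂)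
    (hM : NoSeparation (m₁ + m₂)) (hN : NoSeparation (n₁ + n₂))
    (hc₁ : NoChain n₁) (hc₂ : NoChain n₂)
    (hm0 : ∀ i, m₁ (toLex (i, i)) = 0) (hn0 : ∀ i, n₁ (toLex (i, i)) = 0)
    (hx : ∀ i, rowSum m₁ i + colSum m₂ i = rowSum n₁ i + colSum n₂ i)
    (hy : ∀ i, colSum m₁ i + rowSum m₂ i = colSum n₁ i + rowSum n₂ i) :
    toLex (n₁ + n₂) ≤ toLex (m₁ + m₂) ∧ (m₁ + m₂ = n₁ + n₂ → m₁ = n₁) := by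
  have hrow : ∀ i, rowSum m₁ i + rowSum m₂ i = rowSum n₁ i + rowSum n₂ i := by
    intro i
    rw [← rowSum_add, ← rowSum_add]
    refine hM.rowSum_eq hN (add_nonneg hm₁ hm₂) (add_nonneg hn₁ hn₂) (fun i => ?_) i
    simp only [rowSum_add, colSum_add]
    linarith [hx i, hy i]
  -- By the mixed marginals, `d` is also the column discrepancy between `m₁` and `n₁`, and `-d` is
  -- the row and column discrepancy between `m₂` and `n₂`. This is why diagonal corrections suffice;
  -- splitting `d` into positive and negative parts keeps them nonnegative.
  set d : Fin n → ℤ := fun i => rowSum m₁ i - rowSum n₁ i with hd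
  have hdi : ∀ i, d i = rowSum m₁ i - rowSum n₁ i := fun _ => rfl
  have hd0 : ∀ c, d c ≠ 0 → rowSum (n₁ + n₂) c ≠ 0 ∧ colSum (n₁ + n₂) c ≠ 0 := by
    intro c hc
    rw [rowSum_add, colSum_add]
    have := rowSum_nonneg hm₁ c
    have := rowSum_nonneg hm₂ c
    have := rowSum_nonneg hn₁ c
    have := rowSum_nonneg hn₂ c
    have := colSum_nonneg hm₁ c
    have := colSum_nonneg hm₂ c
    have := colSum_nonneg hn₁ c
    have := colSum_nonneg hn₂ c
    have := hx c
    have := hy c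
    have := hrow c
    rw [hdi] at hc
    constructor
    · intro h0
      apply hc
      linarith
    · intro h0
      apply hc
      linarith
  have hpos : ∀ c, d⁺ c ≠ 0 → d c ≠ 0 := fun c h h0 => h (by simp [Pi.posPart_apply, h0])
  have hneg : ∀ c, d⁻ c ≠ 0 → d c ≠ 0 := fun c h h0 => h (by simp [Pi.negPart_apply, h0])
  have hpn : ∀ c, d⁺ c - d⁻ c = d c := fun c => congrFun (posPart_sub_negPart d) c
  have hsub₁ : ∀ e, n₁ e ≠ 0 → (n₁ + n₂) e ≠ 0 := by
    intro e h
    have h1 : 0 ≤ n₁ e := hn₁ e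
    have h2 : 0 ≤ n₂ e := hn₂ e
    rw [Pi.add_apply]
    omega
  have hsub₂ : ∀ e, n₂ e ≠ 0 → (n₁ + n₂) e ≠ 0 := by
    intro e h
    have h1 : 0 ≤ n₁ e := hn₁ e
    have h2 : 0 ≤ n₂ e := hn₂ e
    rw [Pi.add_apply]
    omega
  have h₁ : toLex (n₁ + diag d⁺) ≤ toLex (m₁ + diag d⁻) := by
    refine (hc₁.add_diag hN hsub₁ fun c h => hd0 c (hpos c h)).toLex_le
      (add_nonneg hm₁ (diag_nonneg (negPart_nonneg d))) (fun i => ?_) (fun i => ?_)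
    · rw [rowSum_add, rowSum_add, rowSum_diag, rowSum_diag]
      linarith [hpn i, hdi i]
    · rw [colSum_add, colSum_add, colSum_diag, colSum_diag]
      linarith [hpn i, hdi i, hx i, hy i, hrow i]
  have h₂ : toLex (n₂ + diag d⁻) ≤ toLex (m₂ + diag d⁺) := by
    refine (hc₂.add_diag hN hsub₂ fun c h => hd0 c (hneg c h)).toLex_le
      (add_nonneg hm₂ (diag_nonneg (posPart_nonneg d))) (fun i => ?_) (fun i => ?_)
    · rw [rowSum_add, rowSum_add, rowSum_diag, rowSum_diag]
      linarith [hpn i, hdi i, hrow i]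
    · rw [colSum_add, colSum_add, colSum_diag, colSum_diag]
      linarith [hpn i, hdi i, hx i, hy i, hrow i]
  -- Both sums acquire the same total correction, so it can be cancelled.
  have hn : toLex (n₁ + diag d⁺) + toLex (n₂ + diag d⁻) =
      toLex (n₁ + n₂) + toLex (diag d⁺ + diag d⁻) := by
    rw [← toLex_add, ← toLex_add]; congr 1; abel
  have hm : toLex (m₁ + diag d⁻) + toLex (m₂ + diag d⁺) =
      toLex (m₁ + m₂) + toLex (diag d⁺ + diag d⁻) := by
    rw [← toLex_add, ← toLex_add]; congr 1; abel
  refine ⟨?_, fun heq => ?_⟩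
  · have := add_le_add h₁ h₂
    rwa [hn, hm, add_le_add_iff_right] at this
  -- Equal totals leave no room for strictness in either inequality. The corrected first summands
  -- then coincide, and off the diagonal the corrections are zero.
  · have heq₁ : toLex (n₁ + diag d⁺) = toLex (m₁ + diag d⁻) := by
      refine h₁.eq_of_not_lt fun hlt => ?_
      have := add_lt_add_of_lt_of_le hlt h₂
      rw [hn, hm, heq] at this
      exact lt_irrefl _ this
    have heq₁ := toLex.injective heq₁
    funext e
    obtain ⟨⟨i, j⟩, rfl⟩ := toLex.surjective e
    by_cases hij : i = j
    · rw [hij, hm0, hn0]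
    · have := congrFun heq₁ (toLex (i, j))
      simpa [diag_apply, hij] using this.symm

end Matrices

end Plucker

namespace Plucker

open MvPolynomial

/-! ### Standard monomials and their encoding as matrices. -/

section Standard

variable {n : ℕ}

/-- The left end of a pair. -/
abbrev lend (e : Index n) : Fin n := (ofLex e.1).1

/-- The right end of a pair. -/
abbrev rend (e : Index n) : Fin n := (ofLex e.1).2

/-- The square matrix with the given entries above the diagonal. -/
def toMatrix (f : Index n → ℕ) : Fin n ×ₗ Fin n → ℤ := fun e =>
  if h : (ofLex e).1 < (ofLex e).2 then (f ⟨e, h⟩ : ℤ) else 0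

theorem toMatrix_apply (f : Index n → ℕ) (i j : Fin n) :
    toMatrix f (toLex (i, j)) = if h : i < j then (f ⟨toLex (i, j), h⟩ : ℤ) else 0 := rfl

theorem toMatrix_coe (f : Index n → ℕ) (e : Index n) : toMatrix f e.1 = f e := dif_pos e.2

theorem toMatrix_ne_zero {f : Index n → ℕ} {i j : Fin n} (h : toMatrix f (toLex (i, j)) ≠ 0) :
    ∃ e : Index n, f e ≠ 0 ∧ lend e = i ∧ rend e = j := by
  rw [toMatrix_apply] at h
  split_ifs at h with hij
  · exact ⟨⟨toLex (i, j), hij⟩, by exact_mod_cast h, rfl, rfl⟩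
  · exact absurd rfl h

theorem toMatrix_nonneg (f : Index n → ℕ) : 0 ≤ toMatrix f := by
  intro e
  unfold toMatrix
  split_ifs
  · exact Int.natCast_nonneg _
  · exact le_rfl

theorem toMatrix_diag (f : Index n → ℕ) (i : Fin n) : toMatrix f (toLex (i, i)) = 0 :=
  dif_neg (lt_irrefl i)

theorem toMatrix_add (f g : Index n → ℕ) : toMatrix (f + g) = toMatrix f + toMatrix g := by
  funext e
  simp only [toMatrix, Pi.add_apply]
  split_ifs
  · push_cast; rfl
  · rfl

theorem toMatrix_injective : Function.Injective (toMatrix (n := n)) := by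
  intro f g h
  funext e
  have := congrFun h e.1
  rw [toMatrix_coe, toMatrix_coe] at this
  exact_mod_cast this

theorem sum_index (F : Fin n ×ₗ Fin n → ℤ) :
    ∑ e : Index n, F e.1 = ∑ i, ∑ j, if i < j then F (toLex (i, j)) else 0 := by
  rw [← Fintype.sum_prod_type' (f := fun i j => if i < j then F (toLex (i, j)) else 0),
    ← Finset.sum_filter,
    Finset.sum_subtype (Finset.univ.filter fun x : Fin n × Fin n => x.1 < x.2)
      (p := fun x : Fin n × Fin n => x.1 < x.2) (by simp)]
  rfl

theorem rowSum_toMatrix (f : Index n → ℕ) (i : Fin n) :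
    rowSum (toMatrix f) i = ∑ e : Index n, if lend e = i then (f e : ℤ) else 0 := by
  have := sum_index (fun e => if (ofLex e).1 = i then toMatrix f e else 0)
  simp only [toMatrix_coe] at this
  rw [this, Finset.sum_eq_single i]
  · refine Finset.sum_congr rfl fun j _ => ?_
    by_cases h : i < j <;> simp [toMatrix_apply, h]
  · intro k _ hk
    simp [hk]
  · simp

theorem colSum_toMatrix (f : Index n → ℕ) (j : Fin n) :
    colSum (toMatrix f) j = ∑ e : Index n, if rend e = j then (f e : ℤ) else 0 := by
  have := sum_index (fun e => if (ofLex e).2 = j then toMatrix f e else 0)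
  simp only [toMatrix_coe] at this
  rw [this]
  refine Finset.sum_congr rfl fun i _ => ?_
  rw [Finset.sum_eq_single j]
  · by_cases h : i < j <;> simp [toMatrix_apply, h]
  · intro k _ hk
    simp [hk]
  · simp

/-- The lexicographic order on monomials is that of the corresponding matrices. -/
theorem toSyn_le_of_toMatrix_le {c d : Index n →₀ ℕ} (h : toLex (toMatrix c) ≤ toLex (toMatrix d)) :
    (lexOrder n).toSyn c ≤ (lexOrder n).toSyn d := by
  by_contra hlt
  obtain ⟨e, he, hde⟩ := MonomialOrder.lex_lt_iff.1 (not_le.1 hlt)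
  refine h.not_gt ⟨e.1, fun e' he' => ?_, ?_⟩
  · simp only [Pi.toLex_apply, toMatrix]
    split_ifs with hlt'
    · exact congrArg Nat.cast (he ⟨e', hlt'⟩ he')
    · rfl
  · simp only [Pi.toLex_apply, toMatrix_coe]
    exact_mod_cast hde

/-- Monomials that are divisible neither by the leading monomial of a quadric nor by that of a
cubic. -/
structure IsStandard (d : Index n → ℕ) : Prop where
  lend_le_rend : ∀ e f, d e ≠ 0 → d f ≠ 0 → lend e ≤ rend f
  no_chain : ∀ e f g, d e ≠ 0 → d f ≠ 0 → d g ≠ 0 → lend e < lend f → rend e < rend f →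
    lend f < lend g → ¬ rend f < rend g

theorem IsStandard.noSeparation {d : Index n → ℕ} (h : IsStandard d) :
    NoSeparation (toMatrix d) := by
  intro i j k l h1 h2
  obtain ⟨e, he, rfl, rfl⟩ := toMatrix_ne_zero h1
  obtain ⟨f, hf, rfl, rfl⟩ := toMatrix_ne_zero h2
  exact h.lend_le_rend e f he hf

/-- A standard monomial is a product of two coprime monomials without strictly increasing pairs. -/
theorem IsStandard.exists_split {d : Index n → ℕ} (h : IsStandard d) :
    ∃ a b : Index n → ℕ, a + b = d ∧ (∀ e, a e = 0 ∨ b e = 0) ∧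
      NoChain (toMatrix a) ∧ NoChain (toMatrix b) := by
  classical
  -- Separate the pairs of `d` lying strictly above another pair of `d` from the minimal ones. A
  -- chain among the former would extend downwards to length three; the latter contain none.
  let P : Index n → Prop := fun e => ∃ f, d f ≠ 0 ∧ lend f < lend e ∧ rend f < rend e
  refine ⟨fun e => if P e then d e else 0, fun e => if P e then 0 else d e, ?_, ?_, ?_, ?_⟩
  · funext e
    by_cases hP : P e <;> simp [hP]
  · intro e
    by_cases hP : P e <;> simp [hP]
  · intro i j k l h1 h2 hik hjl
    obtain ⟨e, he, rfl, rfl⟩ := toMatrix_ne_zero h1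
    obtain ⟨f, hf, rfl, rfl⟩ := toMatrix_ne_zero h2
    simp only [ne_eq, ite_eq_right_iff, Classical.not_imp] at he hf
    obtain ⟨⟨g, hg, hgl, hgr⟩, he⟩ := he
    exact h.no_chain g e f hg he hf.2 hgl hgr hik hjl
  · intro i j k l h1 h2 hik hjl
    obtain ⟨e, he, rfl, rfl⟩ := toMatrix_ne_zero h1
    obtain ⟨f, hf, rfl, rfl⟩ := toMatrix_ne_zero h2
    simp only [ne_eq, ite_eq_left_iff, Classical.not_imp] at he hf
    exact hf.1 ⟨e, he.2, hik, hjl⟩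

end Standard

/-! ### Expansion of products of minors and independence of standard monomials. -/

section Expansion

variable (K : Type*) [Field K] {n : ℕ}

/-- The exponent of `∏ (x_i y_j)^{f_ij} (x_j y_i)^{g_ij}`. -/
noncomputable def mixedExponent (f g : Index n → ℕ) : Fin n ⊕ Fin n →₀ ℕ :=
  ∑ e : Index n, (f e • (Finsupp.single (Sum.inl (lend e)) 1 + Finsupp.single (Sum.inr (rend e)) 1) +
    g e • (Finsupp.single (Sum.inl (rend e)) 1 + Finsupp.single (Sum.inr (lend e)) 1))

theorem mixedExponent_inl (f g : Index n → ℕ) (i : Fin n) :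
    (mixedExponent f g (Sum.inl i) : ℤ) = rowSum (toMatrix f) i + colSum (toMatrix g) i := by
  rw [rowSum_toMatrix, colSum_toMatrix, ← Finset.sum_add_distrib, mixedExponent]
  simp [Finsupp.finsetSum_apply, Finsupp.single_apply]

theorem mixedExponent_inr (f g : Index n → ℕ) (i : Fin n) :
    (mixedExponent f g (Sum.inr i) : ℤ) = colSum (toMatrix f) i + rowSum (toMatrix g) i := by
  rw [rowSum_toMatrix, colSum_toMatrix, ← Finset.sum_add_distrib, mixedExponent]
  simp [Finsupp.finsetSum_apply, Finsupp.single_apply]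

/-- The Plücker coordinate `x_i y_j - x_j y_i`. -/
noncomputable def minor (e : Index n) : MvPolynomial (Fin n ⊕ Fin n) K :=
  X (Sum.inl (lend e)) * X (Sum.inr (rend e)) - X (Sum.inl (rend e)) * X (Sum.inr (lend e))

theorem mem_pluckerIdeal {f : MvPolynomial (Index n) K} :
    f ∈ pluckerIdeal K n ↔ aeval (minor K) f = 0 := Iff.rfl

theorem minor_pow (e : Index n) (k : ℕ) :
    minor K e ^ k = ∑ a ∈ Finset.range (k + 1), monomial
      (a • (Finsupp.single (Sum.inl (lend e)) 1 + Finsupp.single (Sum.inr (rend e)) 1) +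
        (k - a) • (Finsupp.single (Sum.inl (rend e)) 1 + Finsupp.single (Sum.inr (lend e)) 1))
      ((-1 : K) ^ (k - a) * (k.choose a : K)) := by
  have h : minor K e = monomial
      (Finsupp.single (Sum.inl (lend e)) 1 + Finsupp.single (Sum.inr (rend e)) 1) 1 + monomial
      (Finsupp.single (Sum.inl (rend e)) 1 + Finsupp.single (Sum.inr (lend e)) 1) (-1) := by
    rw [minor, sub_eq_add_neg, map_neg]
    simp [X, monomial_mul]
  rw [h, (Commute.all _ _).add_pow]
  refine Finset.sum_congr rfl fun a _ => ?_
  rw [monomial_pow, monomial_pow, monomial_mul, one_pow, one_mul, ← C_eq_coe_nat, mul_comm,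
    C_mul_monomial, mul_comm]

theorem prod_minor_pow (d : Index n → ℕ) :
    ∏ e, minor K e ^ d e = ∑ f ∈ Fintype.piFinset fun e => Finset.range (d e + 1),
      monomial (mixedExponent f (d - f))
        (∏ e, ((-1 : K) ^ (d e - f e) * ((d e).choose (f e) : K))) := by
  simp_rw [minor_pow, Finset.prod_univ_sum]
  refine Finset.sum_congr rfl fun f _ => ?_
  rw [mixedExponent, monomial_sum_prod]
  rfl

theorem exists_of_coeff_prod_minor_pow_ne_zero {d : Index n → ℕ} {w : Fin n ⊕ Fin n →₀ ℕ}
    (h : coeff w (∏ e, minor K e ^ d e) ≠ 0) : ∃ f g, f + g = d ∧ mixedExponent f g = w := by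
  rw [prod_minor_pow, coeff_sum] at h
  obtain ⟨f, hf, hne⟩ := Finset.exists_ne_zero_of_sum_ne_zero h
  rw [coeff_monomial] at hne
  refine ⟨f, d - f, ?_, (ite_ne_right_iff.1 hne).1⟩
  funext e
  have := Fintype.mem_piFinset.1 hf e
  simp only [Finset.mem_range, Pi.add_apply, Pi.sub_apply] at this ⊢
  omega

/-- By uniqueness a single term of the expansion contributes, and coprimality makes its coefficient
a sign in every characteristic. -/
theorem coeff_prod_minor_pow_ne_zero {a b : Index n → ℕ} (hab : ∀ e, a e = 0 ∨ b e = 0)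
    (huniq : ∀ f g, f + g = a + b → mixedExponent f g = mixedExponent a b → f = a) :
    coeff (mixedExponent a b) (∏ e, minor K e ^ (a + b) e) ≠ 0 := by
  rw [prod_minor_pow, coeff_sum, Finset.sum_eq_single a]
  · rw [show a + b - a = b by funext e; simp, coeff_monomial, if_pos rfl]
    refine Finset.prod_ne_zero_iff.2 fun e _ => mul_ne_zero (pow_ne_zero _ (by simp)) ?_
    -- The binomial coefficient is `choose (b e) 0` or `choose (a e) (a e)`, hence `1`.
    rcases hab e with h | h <;> simp [h]
  · intro f hf hfa
    rw [coeff_monomial, if_neg]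
    intro hw
    refine hfa (huniq f _ ?_ hw)
    funext e
    have := Fintype.mem_piFinset.1 hf e
    simp only [Finset.mem_range, Pi.add_apply, Pi.sub_apply] at this ⊢
    omega
  · intro ha
    exact absurd (Fintype.mem_piFinset.2 fun e => by simp) ha

/-- Standard monomials are linearly independent modulo the Plücker ideal. -/
theorem eq_zero_of_isStandard {f : MvPolynomial (Index n) K} (hf : f ∈ pluckerIdeal K n)
    (hstd : ∀ d ∈ f.support, IsStandard d) : f = 0 := by
  by_contra hne
  have hmem := (lexOrder n).degree_mem_support hne
  set d := (lexOrder n).degree f with hd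
  obtain ⟨a, b, hab, hcop, ha, hb⟩ := (hstd d hmem).exists_split
  -- The inequality serves for monomials other than `d`, the implication for other factorizations of
  -- `d` itself.
  have key : ∀ d' ∈ f.support, ∀ f' g' : Index n → ℕ, f' + g' = d' → mixedExponent f' g' = mixedExponent a b →
      toLex (toMatrix a + toMatrix b) ≤ toLex (toMatrix f' + toMatrix g') ∧
        (toMatrix f' + toMatrix g' = toMatrix a + toMatrix b → toMatrix f' = toMatrix a) := by
    intro d' hd' f' g' hfg hw
    refine toLex_add_le_and_eq (toMatrix_nonneg _) (toMatrix_nonneg _) (toMatrix_nonneg _)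
      (toMatrix_nonneg _) ?_ ?_ ha hb (toMatrix_diag _) (toMatrix_diag _) (fun i => ?_) (fun i => ?_)
    · rw [← toMatrix_add, hfg]
      exact (hstd d' hd').noSeparation
    · rw [← toMatrix_add, hab]
      exact (hstd d hmem).noSeparation
    · rw [← mixedExponent_inl, ← mixedExponent_inl, hw]
    · rw [← mixedExponent_inr, ← mixedExponent_inr, hw]
  have h0 : coeff (mixedExponent a b) (aeval (minor K) f) = 0 := by
    rw [(mem_pluckerIdeal K).1 hf, coeff_zero]
  rw [aeval_def, eval₂_eq', coeff_sum, Finset.sum_eq_single d] at h0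
  · rw [algebraMap_eq, coeff_C_mul] at h0
    rcases mul_eq_zero.1 h0 with h0 | h0
    · exact mem_support_iff.1 hmem h0
    · rw [← hab] at h0
      refine coeff_prod_minor_pow_ne_zero K hcop (fun f' g' hfg hw => ?_) h0
      refine toMatrix_injective ((key d hmem f' g' (hfg.trans hab) hw).2 ?_)
      rw [← toMatrix_add, ← toMatrix_add, hfg]
  · intro d' hd' hdd'
    rw [algebraMap_eq, coeff_C_mul]
    -- A contributing `d'` would be at least `d` by `key` and at most `d` because `d` is the leading
    -- exponent.
    by_contra hne'
    obtain ⟨f', g', hfg, hw⟩ := exists_of_coeff_prod_minor_pow_ne_zero K (right_ne_zero_of_mul hne')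
    have hle := (key d' hd' f' g' hfg hw).1
    rw [← toMatrix_add, ← toMatrix_add, hab, hfg] at hle
    exact hdd' ((lexOrder n).toSyn.injective
      (le_antisymm ((lexOrder n).le_degree hd') (toSyn_le_of_toMatrix_le hle)))
  · exact fun h => absurd hmem h

end Expansion

end Plucker

namespace Plucker

open MvPolynomial

/-! ### Squarefree exponents of degree two and three: divisibility, order, standardness. -/

section Exponents

variable {n : ℕ}

/-- The pair `(i, j)` as an index of a Plücker variable. -/
abbrev idx {i j : Fin n} (h : i < j) : Index n := ⟨toLex (i, j), h⟩

theorem idx_lt_idx {i j k l : Fin n} (h : i < j) (h' : k < l) :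
    idx h < idx h' ↔ (i : ℕ) < k ∨ (i : ℕ) = k ∧ (j : ℕ) < l := by
  rw [← Fin.ext_iff]
  exact Prod.Lex.toLex_lt_toLex

theorem lt_of_lend_lt {e f : Index n} (h : lend e < lend f) : e < f :=
  Prod.Lex.lt_iff.2 (Or.inl h)

/-- The exponent of a product of two variables. -/
noncomputable def exp₂ (a b : Index n) : Index n →₀ ℕ := Finsupp.single a 1 + Finsupp.single b 1

/-- The exponent of a product of three variables. -/
noncomputable def exp₃ (a b c : Index n) : Index n →₀ ℕ := Finsupp.single a 1 + exp₂ b c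

theorem exp₂_ne_zero_iff {a b e : Index n} : exp₂ a b e ≠ 0 ↔ e = a ∨ e = b := by
  simp only [exp₂, Finsupp.add_apply, Finsupp.single_apply]
  grind

theorem exp₃_ne_zero_iff {a b c e : Index n} : exp₃ a b c e ≠ 0 ↔ e = a ∨ e = b ∨ e = c := by
  rw [← exp₂_ne_zero_iff]
  simp only [exp₃, Finsupp.add_apply, Finsupp.single_apply]
  grind

theorem exp₂_le_iff {a b : Index n} (h : a < b) {d : Index n →₀ ℕ} :
    exp₂ a b ≤ d ↔ d a ≠ 0 ∧ d b ≠ 0 := by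
  refine ⟨fun hle => ⟨?_, ?_⟩, fun ⟨ha, hb⟩ e => ?_⟩
  · exact ne_of_gt ((Nat.pos_of_ne_zero (exp₂_ne_zero_iff.2 (Or.inl rfl))).trans_le (hle a))
  · exact ne_of_gt ((Nat.pos_of_ne_zero (exp₂_ne_zero_iff.2 (Or.inr rfl))).trans_le (hle b))
  · simp only [exp₂, Finsupp.add_apply, Finsupp.single_apply]
    grind

theorem exp₃_le_iff {a b c : Index n} (h : a < b) (h' : b < c) {d : Index n →₀ ℕ} :
    exp₃ a b c ≤ d ↔ d a ≠ 0 ∧ d b ≠ 0 ∧ d c ≠ 0 := by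
  refine ⟨fun hle => ⟨?_, ?_, ?_⟩, fun ⟨ha, hb, hc⟩ e => ?_⟩
  · exact ne_of_gt ((Nat.pos_of_ne_zero (exp₃_ne_zero_iff.2 (Or.inl rfl))).trans_le (hle a))
  · exact ne_of_gt
      ((Nat.pos_of_ne_zero (exp₃_ne_zero_iff.2 (Or.inr (Or.inl rfl)))).trans_le (hle b))
  · exact ne_of_gt
      ((Nat.pos_of_ne_zero (exp₃_ne_zero_iff.2 (Or.inr (Or.inr rfl)))).trans_le (hle c))
  · simp only [exp₃, exp₂, Finsupp.add_apply, Finsupp.single_apply]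
    grind

theorem eq_of_exp₂_le_exp₂ {a b c d : Index n} (h : a < b) (h' : c < d)
    (hle : exp₂ a b ≤ exp₂ c d) : a = c ∧ b = d := by
  rw [exp₂_le_iff h, exp₂_ne_zero_iff, exp₂_ne_zero_iff] at hle
  grind

theorem eq_of_exp₃_le_exp₃ {a b c a' b' c' : Index n} (h₁ : a < b) (h₂ : b < c) (h₁' : a' < b')
    (h₂' : b' < c') (hle : exp₃ a b c ≤ exp₃ a' b' c') : a = a' ∧ b = b' ∧ c = c' := by
  rw [exp₃_le_iff h₁ h₂, exp₃_ne_zero_iff, exp₃_ne_zero_iff, exp₃_ne_zero_iff] at hle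
  grind

theorem not_exp₃_le_exp₂ {a b c d e : Index n} (h₁ : a < b) (h₂ : b < c) :
    ¬ exp₃ a b c ≤ exp₂ d e := by
  rw [exp₃_le_iff h₁ h₂, exp₂_ne_zero_iff, exp₂_ne_zero_iff, exp₂_ne_zero_iff]
  grind

theorem exp₂_lt {a b c d : Index n} (hab : a < b) (hac : a < c) (had : a < d) :
    (lexOrder n).toSyn (exp₂ c d) < (lexOrder n).toSyn (exp₂ a b) := by
  refine MonomialOrder.lex_lt_iff.2 ⟨a, fun e he => ?_, ?_⟩
  · simp [exp₂, he.ne', (he.trans hab).ne', (he.trans hac).ne', (he.trans had).ne']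
  · simp [exp₂, hac.ne', had.ne']

theorem exp₃_lt {a b c d e f : Index n} (hab : a < b) (hac : a < c) (had : a < d) (hae : a < e)
    (haf : a < f) : (lexOrder n).toSyn (exp₃ d e f) < (lexOrder n).toSyn (exp₃ a b c) := by
  refine MonomialOrder.lex_lt_iff.2 ⟨a, fun x hx => ?_, ?_⟩
  · simp [exp₃, exp₂, hx.ne', (hx.trans hab).ne', (hx.trans hac).ne', (hx.trans had).ne',
      (hx.trans hae).ne', (hx.trans haf).ne']
  · simp [exp₃, exp₂, had.ne', hae.ne', haf.ne']

theorem exp₃_lt_of_eq {a b c d e : Index n} (hbc : b < c) (hbd : b < d) (hbe : b < e) :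
    (lexOrder n).toSyn (exp₃ a d e) < (lexOrder n).toSyn (exp₃ a b c) := by
  simp only [exp₃, map_add]
  exact add_lt_add_right (exp₂_lt hbc hbd hbe) _

theorem isStandard_exp₂ {a b : Index n} (h : lend a ≤ rend b) (h' : lend b ≤ rend a) :
    IsStandard (exp₂ a b) where
  lend_le_rend e f he hf := by
    have ha := a.2
    have hb := b.2
    rw [exp₂_ne_zero_iff] at he hf
    rcases he with rfl | rfl <;> rcases hf with rfl | rfl <;> first | assumption | exact le_of_lt ‹_›
  no_chain e f g he hf hg h₁ _ h₂ _ := by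
    rw [exp₂_ne_zero_iff] at he hf hg
    rcases he with rfl | rfl <;> rcases hf with rfl | rfl <;> rcases hg with rfl | rfl <;> omega

/-- Since `lend c` is the largest left end, only right ends need comparing with it; and a chain of
length three would have to be `a`, `b`, `c` in this order. -/
theorem isStandard_exp₃ {a b c : Index n} (hab : lend a < lend b) (hbc : lend b < lend c)
    (ha : lend c ≤ rend a) (hb : lend c ≤ rend b) (hc : ¬ (rend a < rend b ∧ rend b < rend c)) :
    IsStandard (exp₃ a b c) where
  lend_le_rend e f he hf := by
    have : lend c < rend c := c.2
    rw [exp₃_ne_zero_iff] at he hf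
    rcases he with rfl | rfl | rfl <;> rcases hf with rfl | rfl | rfl <;> omega
  no_chain e f g he hf hg h₁ h₂ h₃ h₄ := by
    rw [exp₃_ne_zero_iff] at he hf hg
    rcases he with rfl | rfl | rfl <;> rcases hf with rfl | rfl | rfl <;>
      rcases hg with rfl | rfl | rfl <;> omega

end Exponents

/-! ### Leading terms, tails and ideal membership of the quadrics and cubics. -/

section Polynomials

variable (K : Type*) [Field K] {n : ℕ}

theorem p_eq {i j : Fin n} (h : i < j) : p K i j = X (idx h) := dif_pos h

theorem X_mul_X (a b : Index n) : (X a * X b : MvPolynomial (Index n) K) = monomial (exp₂ a b) 1 := by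
  simp [X, monomial_mul, exp₂]

theorem X_mul_X_mul_X (a b c : Index n) :
    (X a * X b * X c : MvPolynomial (Index n) K) = monomial (exp₃ a b c) 1 := by
  simp [X, monomial_mul, exp₃, exp₂, add_assoc]

variable {K}

theorem degree_and_leadingCoeff {m : MonomialOrder (Index n)} {f r : MvPolynomial (Index n) K}
    {d : Index n →₀ ℕ} (hf : f = monomial d 1 + r) (hd : d ≠ 0)
    (hr : ∀ c ∈ r.support, m.toSyn c < m.toSyn d) : m.degree f = d ∧ m.leadingCoeff f = 1 := by
  have hdeg : m.degree (monomial d (1 : K)) = d := by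
    classical
    rw [MonomialOrder.degree_monomial, if_neg one_ne_zero]
  have hlt : m.toSyn (m.degree r) < m.toSyn (m.degree (monomial d (1 : K))) := by
    rw [hdeg]
    refine (MonomialOrder.degree_lt_iff ?_).2 hr
    -- The zero polynomial has degree `0` by convention, so for `r = 0` the comparison needs `d ≠
    -- 0`.
    rw [map_zero, MonomialOrder.toSyn_lt_iff_ne_zero, ne_eq, MonomialOrder.toSyn_eq_zero_iff]
    exact hd
  rw [hf, MonomialOrder.degree_add_of_lt hlt, MonomialOrder.leadingCoeff_add_of_lt hlt]
  exact ⟨hdeg, MonomialOrder.leadingCoeff_monomial _⟩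

theorem exp₂_ne_zero (a b : Index n) : exp₂ a b ≠ 0 :=
  fun h => (exp₂_ne_zero_iff (a := a) (b := b)).2 (Or.inl rfl) (by rw [h]; rfl)

theorem exp₃_ne_zero (a b c : Index n) : exp₃ a b c ≠ 0 :=
  fun h => (exp₃_ne_zero_iff (a := a) (b := b) (c := c)).2 (Or.inl rfl) (by rw [h]; rfl)

theorem mem_support_add {f g : MvPolynomial (Index n) K} {c : Index n →₀ ℕ}
    (h : c ∈ (f + g).support) : c ∈ f.support ∨ c ∈ g.support := by
  classical exact Finset.mem_union.1 (support_add h)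

theorem mem_support_sub {f g : MvPolynomial (Index n) K} {c : Index n →₀ ℕ}
    (h : c ∈ (f - g).support) : c ∈ f.support ∨ c ∈ g.support := by
  classical exact Finset.mem_union.1 (support_sub _ f g h)

theorem mem_support_monomial {d c : Index n →₀ ℕ} {a : K}
    (h : c ∈ (monomial d a).support) : c = d :=
  Finset.mem_singleton.1 (support_monomial_subset h)

variable (K)

/-- The bound on the tail gives the leading term; its standardness is what later makes the basis
reduced. -/
theorem quadric_eq {i j k l : Fin n} (hij : i < j) (hjk : j < k) (hkl : k < l) :
    ∃ r, quadric K i j k l = monomial (exp₂ (idx hij) (idx hkl)) 1 + r ∧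
      ∀ c ∈ r.support, (lexOrder n).toSyn c < (lexOrder n).toSyn (exp₂ (idx hij) (idx hkl)) ∧
        IsStandard c := by
  have hik := hij.trans hjk
  have hjl := hjk.trans hkl
  have hil := hik.trans hkl
  refine ⟨monomial (exp₂ (idx hil) (idx hjk)) 1 - monomial (exp₂ (idx hik) (idx hjl)) 1, ?_, ?_⟩
  · simp only [quadric, p_eq K, hij, hkl, hik, hjl, hil, hjk, ← X_mul_X]
    ring
  · intro c hc
    rcases mem_support_sub hc with hc | hc <;> obtain rfl := mem_support_monomial hc
    · refine ⟨exp₂_lt ?_ ?_ ?_, isStandard_exp₂ ?_ ?_⟩ <;>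
        simp only [idx_lt_idx, true_and, lend, rend, ofLex_toLex] <;> omega
    · refine ⟨exp₂_lt ?_ ?_ ?_, isStandard_exp₂ ?_ ?_⟩ <;>
        simp only [idx_lt_idx, true_and, lend, rend, ofLex_toLex] <;> omega

theorem cubic5_eq {i j k l m : Fin n} (hij : i < j) (hjk : j < k) (hkl : k < l) (hlm : l < m)
    (hik : i < k) (hjl : j < l) (hkm : k < m) :
    ∃ r, cubic5 K i j k l m = monomial (exp₃ (idx hik) (idx hjl) (idx hkm)) 1 + r ∧
      ∀ c ∈ r.support, (lexOrder n).toSyn c <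
        (lexOrder n).toSyn (exp₃ (idx hik) (idx hjl) (idx hkm)) ∧ IsStandard c := by
  have hil := hik.trans hkl
  have him := hik.trans hkm
  have hjm := hjl.trans hlm
  refine ⟨monomial (exp₃ (idx him) (idx hjk) (idx hkl)) 1
    - monomial (exp₃ (idx hik) (idx hjm) (idx hkl)) 1
    - monomial (exp₃ (idx hil) (idx hjk) (idx hkm)) 1, ?_, ?_⟩
  · simp only [cubic5, p_eq K, hkl, hik, hjl, hil, hjk, hkm, him, hjm, ← X_mul_X_mul_X]
    ring
  · intro c hc
    rcases mem_support_sub hc with hc | hc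
    · rcases mem_support_sub hc with hc | hc <;> obtain rfl := mem_support_monomial hc
      · refine ⟨exp₃_lt ?_ ?_ ?_ ?_ ?_, isStandard_exp₃ ?_ ?_ ?_ ?_ ?_⟩ <;>
          simp only [idx_lt_idx, true_and, lend, rend, ofLex_toLex] <;> omega
      · refine ⟨exp₃_lt_of_eq ?_ ?_ ?_, isStandard_exp₃ ?_ ?_ ?_ ?_ ?_⟩ <;>
          simp only [idx_lt_idx, true_and, lend, rend, ofLex_toLex] <;> omega
    · obtain rfl := mem_support_monomial hc
      refine ⟨exp₃_lt ?_ ?_ ?_ ?_ ?_, isStandard_exp₃ ?_ ?_ ?_ ?_ ?_⟩ <;>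
        simp only [idx_lt_idx, true_and, lend, rend, ofLex_toLex] <;> omega

/-- Standardness of the tail is not available here: the factors `p_jk p_ls` and `p_jk p_lm` are
leading monomials of quadrics. -/
theorem cubic6_eq {i j k l m s : Fin n} (hij : i < j) (hjk : j < k) (hkl : k < l) (hlm : l < m)
    (hms : m < s) (hil : i < l) (hjm : j < m) (hks : k < s) :
    ∃ r, cubic6 K i j k l m s = monomial (exp₃ (idx hil) (idx hjm) (idx hks)) 1 + r ∧
      ∀ c ∈ r.support, (lexOrder n).toSyn c <
        (lexOrder n).toSyn (exp₃ (idx hil) (idx hjm) (idx hks)) := by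
  have him := hil.trans hlm
  have his := him.trans hms
  have hjs := hjm.trans hms
  have hkm := hkl.trans hlm
  have hls := hlm.trans hms
  refine ⟨monomial (exp₃ (idx his) (idx hjk) (idx hlm)) 1
    - monomial (exp₃ (idx hil) (idx hjs) (idx hkm)) 1
    - monomial (exp₃ (idx him) (idx hjk) (idx hls)) 1, ?_, ?_⟩
  · simp only [cubic6, p_eq K, him, his, hjs, hkm, hls, hil, hjk, hjm, hks, hlm, ← X_mul_X_mul_X]
    ring
  · intro c hc
    rcases mem_support_sub hc with hc | hc
    · rcases mem_support_sub hc with hc | hc <;> obtain rfl := mem_support_monomial hc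
      · refine exp₃_lt ?_ ?_ ?_ ?_ ?_ <;> simp only [idx_lt_idx, true_and] <;> omega
      · refine exp₃_lt_of_eq ?_ ?_ ?_ <;> simp only [idx_lt_idx, true_and] <;> omega
    · obtain rfl := mem_support_monomial hc
      refine exp₃_lt ?_ ?_ ?_ ?_ ?_ <;> simp only [idx_lt_idx, true_and] <;> omega

theorem cubic6'_eq {i j k l m s : Fin n} (hij : i < j) (hjk : j < k) (hkl : k < l) (hlm : l < m)
    (hms : m < s) (hil : i < l) (hjm : j < m) (hks : k < s) :
    ∃ r, cubic6' K i j k l m s = monomial (exp₃ (idx hil) (idx hjm) (idx hks)) 1 + r ∧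
      ∀ c ∈ r.support, (lexOrder n).toSyn c <
        (lexOrder n).toSyn (exp₃ (idx hil) (idx hjm) (idx hks)) ∧ IsStandard c := by
  have him := hil.trans hlm
  have his := him.trans hms
  have hjl := hjk.trans hkl
  have hjs := hjm.trans hms
  have hkm := hkl.trans hlm
  refine ⟨monomial (exp₃ (idx him) (idx hjs) (idx hkl)) 1
    + monomial (exp₃ (idx his) (idx hjl) (idx hkm)) 1
    - monomial (exp₃ (idx hil) (idx hjs) (idx hkm)) 1
    - monomial (exp₃ (idx him) (idx hjl) (idx hks)) 1
    - monomial (exp₃ (idx his) (idx hjm) (idx hkl)) 1, ?_, ?_⟩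
  · simp only [cubic6', p_eq K, him, his, hjl, hjs, hkm, hil, hjm, hks, hkl, ← X_mul_X_mul_X]
    ring
  · intro c hc
    have hc : c = exp₃ (idx hil) (idx hjs) (idx hkm) ∨ c = exp₃ (idx him) (idx hjs) (idx hkl) ∨
        c = exp₃ (idx his) (idx hjl) (idx hkm) ∨ c = exp₃ (idx him) (idx hjl) (idx hks) ∨
        c = exp₃ (idx his) (idx hjm) (idx hkl) := by
      rcases mem_support_sub hc with hc | hc
      · rcases mem_support_sub hc with hc | hc
        · rcases mem_support_sub hc with hc | hc
          · rcases mem_support_add hc with hc | hc <;> simp [mem_support_monomial hc]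
          · simp [mem_support_monomial hc]
        · simp [mem_support_monomial hc]
      · simp [mem_support_monomial hc]
    rcases hc with rfl | hc
    · refine ⟨exp₃_lt_of_eq ?_ ?_ ?_, isStandard_exp₃ ?_ ?_ ?_ ?_ ?_⟩ <;>
        simp only [idx_lt_idx, true_and, lend, rend, ofLex_toLex] <;> omega
    · rcases hc with rfl | rfl | rfl | rfl <;>
      · refine ⟨exp₃_lt ?_ ?_ ?_ ?_ ?_, isStandard_exp₃ ?_ ?_ ?_ ?_ ?_⟩ <;>
          simp only [idx_lt_idx, true_and, lend, rend, ofLex_toLex] <;> omega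

theorem quadric_mem {i j k l : Fin n} (hij : i < j) (hjk : j < k) (hkl : k < l) :
    quadric K i j k l ∈ pluckerIdeal K n := by
  have hik := hij.trans hjk
  have hjl := hjk.trans hkl
  have hil := hik.trans hkl
  rw [mem_pluckerIdeal]
  simp only [quadric, p_eq K, hij, hkl, hik, hjl, hil, hjk, map_add, map_sub, map_mul, aeval_X,
    minor, lend, rend, ofLex_toLex]
  ring

theorem cubic5_mem {i j k l m : Fin n} (hij : i < j) (hjk : j < k) (hkl : k < l) (hlm : l < m) :
    cubic5 K i j k l m ∈ pluckerIdeal K n := by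
  have hik := hij.trans hjk
  have hjl := hjk.trans hkl
  have hkm := hkl.trans hlm
  have hil := hik.trans hkl
  have him := hik.trans hkm
  have hjm := hjl.trans hlm
  rw [mem_pluckerIdeal]
  simp only [cubic5, p_eq K, hkl, hik, hjl, hil, hjk, hkm, him, hjm, map_add, map_sub, map_mul,
    aeval_X, minor, lend, rend, ofLex_toLex]
  ring

theorem cubic6'_mem {i j k l m s : Fin n} (hij : i < j) (hjk : j < k) (hkl : k < l) (hlm : l < m)
    (hms : m < s) : cubic6' K i j k l m s ∈ pluckerIdeal K n := by
  have hjl := hjk.trans hkl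
  have hil := hij.trans hjl
  have him := hil.trans hlm
  have his := him.trans hms
  have hjm := hjl.trans hlm
  have hjs := hjm.trans hms
  have hkm := hkl.trans hlm
  have hks := hkm.trans hms
  rw [mem_pluckerIdeal]
  simp only [cubic6', p_eq K, him, his, hjl, hjs, hkm, hil, hjm, hks, hkl, map_add, map_sub, map_mul,
    aeval_X, minor, lend, rend, ofLex_toLex]
  ring

theorem cubic6'_eq_cubic6_add (i j k l m s : Fin n) :
    cubic6' K i j k l m s =
      cubic6 K i j k l m s + p K i m * quadric K j k l s - p K i s * quadric K j k l m := by
  simp only [cubic6', cubic6, quadric]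
  ring

theorem cubic6_mem {i j k l m s : Fin n} (hij : i < j) (hjk : j < k) (hkl : k < l) (hlm : l < m)
    (hms : m < s) : cubic6 K i j k l m s ∈ pluckerIdeal K n := by
  have h : cubic6 K i j k l m s = cubic6' K i j k l m s - p K i m * quadric K j k l s +
      p K i s * quadric K j k l m := by
    rw [cubic6'_eq_cubic6_add]
    ring
  rw [h]
  exact add_mem (sub_mem (cubic6'_mem K hij hjk hkl hlm hms)
    (Ideal.mul_mem_left _ _ (quadric_mem K hjk hkl (hlm.trans hms))))
    (Ideal.mul_mem_left _ _ (quadric_mem K hjk hkl hlm))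

end Polynomials

end Plucker

namespace Plucker

open MvPolynomial

/-! ### Counting increasing index tuples. -/

section Counting

theorem ncard_strictMono (n k : ℕ) : {φ : Fin k → Fin n | StrictMono φ}.ncard = n.choose k := by
  classical
  have h : ((Finset.powersetCard k (Finset.univ : Finset (Fin n))) : Set (Finset (Fin n))).ncard =
      n.choose k := by
    rw [Set.ncard_coe_finset, Finset.card_powersetCard, Finset.card_univ, Fintype.card_fin]
  rw [← h]
  refine Set.ncard_congr (fun φ _ => Finset.univ.image φ) (fun φ hφ => ?_) (fun φ ψ hφ hψ hφψ => ?_)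
    (fun s hs => ?_)
  · simp [Finset.card_image_of_injective _ (StrictMono.injective hφ)]
  · have hcard : (Finset.univ.image φ).card = k := by
      simp [Finset.card_image_of_injective _ (StrictMono.injective hφ)]
    rw [Finset.orderEmbOfFin_unique hcard (fun i => by simp) hφ]
    exact (Finset.orderEmbOfFin_unique hcard (fun i => by simp [hφψ]) hψ).symm
  · have hcard : s.card = k := (Finset.mem_powersetCard.1 (Finset.mem_coe.1 hs)).2
    refine ⟨s.orderEmbOfFin hcard, (s.orderEmbOfFin hcard).strictMono, ?_⟩
    exact Finset.coe_injective (by simp)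

end Counting

/-! ### The generating sets, treated uniformly for both families of six-index cubics. -/

section Generators

variable (K : Type*) [Field K] {n : ℕ}

theorem quadric_lead {i j k l : Fin n} (hij : i < j) (hjk : j < k) (hkl : k < l) :
    (lexOrder n).degree (quadric K i j k l) = exp₂ (idx hij) (idx hkl) ∧
      (lexOrder n).leadingCoeff (quadric K i j k l) = 1 := by
  obtain ⟨r, h, hr⟩ := quadric_eq K hij hjk hkl
  exact degree_and_leadingCoeff h (exp₂_ne_zero _ _) fun c hc => (hr c hc).1

theorem cubic5_lead {i j k l m : Fin n} (hij : i < j) (hjk : j < k) (hkl : k < l) (hlm : l < m)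
    (hik : i < k) (hjl : j < l) (hkm : k < m) :
    (lexOrder n).degree (cubic5 K i j k l m) = exp₃ (idx hik) (idx hjl) (idx hkm) ∧
      (lexOrder n).leadingCoeff (cubic5 K i j k l m) = 1 := by
  obtain ⟨r, h, hr⟩ := cubic5_eq K hij hjk hkl hlm hik hjl hkm
  exact degree_and_leadingCoeff h (exp₃_ne_zero _ _ _) fun c hc => (hr c hc).1

variable {K}

/-- A family of six-index cubics in the Plücker ideal with leading terms `p_il p_jm p_ks`. -/
structure IsCubicFamily
    (C : Fin n → Fin n → Fin n → Fin n → Fin n → Fin n → MvPolynomial (Index n) K) : Prop where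
  mem : ∀ {i j k l m s : Fin n}, i < j → j < k → k < l → l < m → m < s →
    C i j k l m s ∈ pluckerIdeal K n
  lead : ∀ {i j k l m s : Fin n}, i < j → j < k → k < l → l < m → m < s →
    ∀ (hil : i < l) (hjm : j < m) (hks : k < s),
    (lexOrder n).degree (C i j k l m s) = exp₃ (idx hil) (idx hjm) (idx hks) ∧
      (lexOrder n).leadingCoeff (C i j k l m s) = 1

variable (K) in
theorem isCubicFamily_cubic6 : IsCubicFamily (n := n) (cubic6 K) where
  mem := cubic6_mem K
  lead hij hjk hkl hlm hms hil hjm hks := by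
    obtain ⟨r, h, hr⟩ := cubic6_eq K hij hjk hkl hlm hms hil hjm hks
    exact degree_and_leadingCoeff h (exp₃_ne_zero _ _ _) hr

variable (K) in
theorem isCubicFamily_cubic6' : IsCubicFamily (n := n) (cubic6' K) where
  mem := cubic6'_mem K
  lead hij hjk hkl hlm hms hil hjm hks := by
    obtain ⟨r, h, hr⟩ := cubic6'_eq K hij hjk hkl hlm hms hil hjm hks
    exact degree_and_leadingCoeff h (exp₃_ne_zero _ _ _) fun c hc => (hr c hc).1

/-- The set of the cubics of a six-index family. -/
def cubicSet (C : Fin n → Fin n → Fin n → Fin n → Fin n → Fin n → MvPolynomial (Index n) K) :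
    Set (MvPolynomial (Index n) K) :=
  {f | ∃ i j k l m s : Fin n,
    i < j ∧ j < k ∧ k < l ∧ l < m ∧ m < s ∧ f = C i j k l m s}

/-- The quadrics, the five-index cubics and a family of six-index cubics. -/
def generators (C : Fin n → Fin n → Fin n → Fin n → Fin n → Fin n → MvPolynomial (Index n) K) :
    Set (MvPolynomial (Index n) K) :=
  quadrics K n ∪ (cubics5 K n ∪ cubicSet C)

/-- Three pairs in strictly increasing position, no two of which are separated. -/
structure IsChain (a b c : Index n) : Prop where
  lend₁ : lend a < lend b
  lend₂ : lend b < lend c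
  rend₁ : rend a < rend b
  rend₂ : rend b < rend c
  lend_le : lend c ≤ rend a

variable {C : Fin n → Fin n → Fin n → Fin n → Fin n → Fin n → MvPolynomial (Index n) K}

/-- Writing each generator through the pairs in its leading monomial lets equality of these pairs
yield equality of generators. Whether `lend c` equals `rend a` or is smaller distinguishes the two
kinds of cubics. -/
theorem degree_of_mem (hC : IsCubicFamily C) {g : MvPolynomial (Index n) K} (hg : g ∈ generators C) :
    (∃ a b, rend a < lend b ∧ g = quadric K (lend a) (rend a) (lend b) (rend b) ∧
      (lexOrder n).degree g = exp₂ a b) ∨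
    (∃ a b c, IsChain a b c ∧ lend c = rend a ∧
      g = cubic5 K (lend a) (lend b) (lend c) (rend b) (rend c) ∧
      (lexOrder n).degree g = exp₃ a b c) ∨
    (∃ a b c, IsChain a b c ∧ lend c < rend a ∧
      g = C (lend a) (lend b) (lend c) (rend a) (rend b) (rend c) ∧
      (lexOrder n).degree g = exp₃ a b c) := by
  rcases hg with ⟨i, j, k, l, hij, hjk, hkl, rfl⟩ | ⟨i, j, k, l, m, hij, hjk, hkl, hlm, rfl⟩ |
    ⟨i, j, k, l, m, s, hij, hjk, hkl, hlm, hms, rfl⟩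
  · exact Or.inl ⟨idx hij, idx hkl, hjk, rfl, (quadric_lead K hij hjk hkl).1⟩
  · exact Or.inr (Or.inl ⟨idx (hij.trans hjk), idx (hjk.trans hkl), idx (hkl.trans hlm),
      ⟨hij, hjk, hkl, hlm, le_rfl⟩, rfl, rfl, (cubic5_lead K hij hjk hkl hlm _ _ _).1⟩)
  · exact Or.inr (Or.inr ⟨idx ((hij.trans hjk).trans hkl), idx ((hjk.trans hkl).trans hlm),
      idx ((hkl.trans hlm).trans hms), ⟨hij, hjk, hlm, hms, hkl.le⟩, hkl, rfl,
      (hC.lead hij hjk hkl hlm hms _ _ _).1⟩)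

theorem leadingCoeff_of_mem (hC : IsCubicFamily C) {g : MvPolynomial (Index n) K}
    (hg : g ∈ generators C) : (lexOrder n).leadingCoeff g = 1 := by
  rcases hg with ⟨i, j, k, l, hij, hjk, hkl, rfl⟩ | ⟨i, j, k, l, m, hij, hjk, hkl, hlm, rfl⟩ |
    ⟨i, j, k, l, m, s, hij, hjk, hkl, hlm, hms, rfl⟩
  · exact (quadric_lead K hij hjk hkl).2
  · exact (cubic5_lead K hij hjk hkl hlm (hij.trans hjk) (hjk.trans hkl) (hkl.trans hlm)).2
  · exact (hC.lead hij hjk hkl hlm hms ((hij.trans hjk).trans hkl) ((hjk.trans hkl).trans hlm)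
      ((hkl.trans hlm).trans hms)).2

theorem generators_subset (hC : IsCubicFamily C) :
    generators C ⊆ (pluckerIdeal K n : Set (MvPolynomial (Index n) K)) := by
  rintro g (⟨i, j, k, l, hij, hjk, hkl, rfl⟩ | ⟨i, j, k, l, m, hij, hjk, hkl, hlm, rfl⟩ |
    ⟨i, j, k, l, m, s, hij, hjk, hkl, hlm, hms, rfl⟩)
  · exact quadric_mem K hij hjk hkl
  · exact cubic5_mem K hij hjk hkl hlm
  · exact hC.mem hij hjk hkl hlm hms

theorem IsChain.lend_le_rend {a b c e f : Index n} (h : IsChain a b c)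
    (he : exp₃ a b c e ≠ 0) (hf : exp₃ a b c f ≠ 0) : lend e ≤ rend f := by
  obtain ⟨h₁, h₂, h₃, h₄, h₅⟩ := h
  rw [exp₃_ne_zero_iff] at he hf
  rcases he with rfl | rfl | rfl <;> rcases hf with rfl | rfl | rfl <;> omega

theorem IsChain.lt₁ {a b c : Index n} (h : IsChain a b c) : a < b := lt_of_lend_lt h.lend₁

theorem IsChain.lt₂ {a b c : Index n} (h : IsChain a b c) : b < c := lt_of_lend_lt h.lend₂

theorem lt_of_rend_lt_lend {a b : Index n} (h : rend a < lend b) : a < b :=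
  lt_of_lend_lt (lt_trans a.2 h)

/-- The leading monomials of the generators form an antichain. -/
theorem eq_of_degree_le (hC : IsCubicFamily C) {g h : MvPolynomial (Index n) K}
    (hg : g ∈ generators C) (hh : h ∈ generators C)
    (hle : (lexOrder n).degree h ≤ (lexOrder n).degree g) : h = g := by
  rcases degree_of_mem hC hh with ⟨a, b, hab, rfl, hd⟩ | ⟨a, b, c, habc, hca, rfl, hd⟩ |
      ⟨a, b, c, habc, hca, rfl, hd⟩ <;>
    rcases degree_of_mem hC hg with ⟨a', b', hab', rfl, hd'⟩ | ⟨a', b', c', habc', hca', rfl, hd'⟩ |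
      ⟨a', b', c', habc', hca', rfl, hd'⟩ <;>
    rw [hd, hd'] at hle
  · obtain ⟨rfl, rfl⟩ :=
      eq_of_exp₂_le_exp₂ (lt_of_rend_lt_lend hab) (lt_of_rend_lt_lend hab') hle
    rfl
  · rw [exp₂_le_iff (lt_of_rend_lt_lend hab)] at hle
    exact absurd hab (habc'.lend_le_rend hle.2 hle.1).not_gt
  · rw [exp₂_le_iff (lt_of_rend_lt_lend hab)] at hle
    exact absurd hab (habc'.lend_le_rend hle.2 hle.1).not_gt
  · exact absurd hle (not_exp₃_le_exp₂ habc.lt₁ habc.lt₂)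
  · obtain ⟨rfl, rfl, rfl⟩ := eq_of_exp₃_le_exp₃ habc.lt₁ habc.lt₂ habc'.lt₁ habc'.lt₂ hle
    rfl
  · obtain ⟨rfl, rfl, rfl⟩ := eq_of_exp₃_le_exp₃ habc.lt₁ habc.lt₂ habc'.lt₁ habc'.lt₂ hle
    exact absurd hca hca'.ne
  · exact absurd hle (not_exp₃_le_exp₂ habc.lt₁ habc.lt₂)
  · obtain ⟨rfl, rfl, rfl⟩ := eq_of_exp₃_le_exp₃ habc.lt₁ habc.lt₂ habc'.lt₁ habc'.lt₂ hle
    exact absurd hca' hca.ne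
  · obtain ⟨rfl, rfl, rfl⟩ := eq_of_exp₃_le_exp₃ habc.lt₁ habc.lt₂ habc'.lt₁ habc'.lt₂ hle
    rfl

theorem IsStandard.not_degree_le (hC : IsCubicFamily C) {d : Index n →₀ ℕ} (hd : IsStandard d)
    {g : MvPolynomial (Index n) K} (hg : g ∈ generators C) : ¬ (lexOrder n).degree g ≤ d := by
  intro hle
  rcases degree_of_mem hC hg with ⟨a, b, hab, -, h⟩ | ⟨a, b, c, habc, -, -, h⟩ |
    ⟨a, b, c, habc, -, -, h⟩ <;> rw [h] at hle
  · rw [exp₂_le_iff (lt_of_rend_lt_lend hab)] at hle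
    exact absurd hab (hd.lend_le_rend _ _ hle.2 hle.1).not_gt
  all_goals
    rw [exp₃_le_iff habc.lt₁ habc.lt₂] at hle
    exact hd.no_chain _ _ _ hle.1 hle.2.1 hle.2.2 habc.lend₁ habc.rend₁ habc.lend₂ habc.rend₂

/-- Every forbidden configuration of pairs is exactly the leading monomial of some generator: a
separated pair belongs to a quadric, an unseparated chain of three to a cubic. -/
theorem isStandard_of_forall (hC : IsCubicFamily C) {d : Index n →₀ ℕ}
    (hd : ∀ g ∈ generators C, ¬ (lexOrder n).degree g ≤ d) : IsStandard d := by
  have hsep : ∀ e f, d e ≠ 0 → d f ≠ 0 → lend e ≤ rend f := by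
    intro e f he hf
    by_contra! hlt
    refine hd _ (Or.inl ⟨lend f, rend f, lend e, rend e, f.2, hlt, e.2, rfl⟩) ?_
    rw [(quadric_lead K f.2 hlt e.2).1]
    exact (exp₂_le_iff (lt_of_rend_lt_lend hlt)).2 ⟨hf, he⟩
  refine ⟨hsep, fun e f g he hf hg h₁ h₂ h₃ h₄ => ?_⟩
  have hle : exp₃ e f g ≤ d :=
    (exp₃_le_iff (lt_of_lend_lt h₁) (lt_of_lend_lt h₃)).2 ⟨he, hf, hg⟩
  -- The six ends of the chain are distinct exactly when `lend g < rend e`; if these two coincide,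
  -- five indices remain.
  rcases (hsep g e hg he).lt_or_eq with hlt | heq
  · refine hd _ (Or.inr (Or.inr ⟨lend e, lend f, lend g, rend e, rend f, rend g,
      h₁, h₃, hlt, h₂, h₄, rfl⟩)) ?_
    rw [(hC.lead h₁ h₃ hlt h₂ h₄ e.2 f.2 g.2).1]
    exact hle
  · have h₂' : lend g < rend f := heq ▸ h₂
    have he' : lend e < lend g := h₁.trans h₃
    refine hd _ (Or.inr (Or.inl ⟨lend e, lend f, lend g, rend f, rend g,
      h₁, h₃, h₂', h₄, rfl⟩)) ?_
    rw [(cubic5_lead K h₁ h₃ h₂' h₄ he' f.2 g.2).1]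
    have : idx he' = e := Subtype.ext (congrArg toLex (Prod.ext rfl heq))
    rw [this]
    exact hle

/-- The leading monomial of a nonzero element of the Plücker ideal is divisible by that of a
generator. -/
theorem exists_degree_le (hC : IsCubicFamily C) {f : MvPolynomial (Index n) K}
    (hf : f ∈ pluckerIdeal K n) (hf0 : f ≠ 0) :
    ∃ g ∈ generators C, (lexOrder n).degree g ≤ (lexOrder n).degree f := by
  -- The remainder lies in the ideal and has only standard monomials, so it vanishes. The leading
  -- monomial of `f` then occurs in some product `b * q b`, whose degree cannot exceed that of `f`.
  obtain ⟨q, r, hfr, hq, hr⟩ := (lexOrder n).div_set (B := generators C)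
    (fun b hb => by rw [leadingCoeff_of_mem hC hb]; exact isUnit_one) f
  have hlin : Finsupp.linearCombination _ (fun b : generators C => (b : MvPolynomial (Index n) K)) q
      ∈ pluckerIdeal K n := by
    rw [Finsupp.linearCombination_apply]
    exact sum_mem fun b _ => Ideal.mul_mem_left _ _ (generators_subset hC b.2)
  have hrI : r ∈ pluckerIdeal K n := by
    have : r = f - Finsupp.linearCombination _
        (fun b : generators C => (b : MvPolynomial (Index n) K)) q := by rw [hfr]; ring
    rw [this]
    exact sub_mem hf hlin
  have hr0 := eq_zero_of_isStandard K hrI fun d hd => isStandard_of_forall hC (hr d hd)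
  rw [hr0, add_zero, Finsupp.linearCombination_apply, Finsupp.sum] at hfr
  have hcoeff := (MonomialOrder.coeff_degree_ne_zero_iff (m := lexOrder n)).2 hf0
  conv at hcoeff =>
    enter [1, 2]
    rw [hfr]
  rw [coeff_sum] at hcoeff
  obtain ⟨b, -, hb⟩ := Finset.exists_ne_zero_of_sum_ne_zero hcoeff
  have hb' : coeff ((lexOrder n).degree f) ((b : MvPolynomial (Index n) K) * q b) ≠ 0 := by
    rwa [mul_comm, ← smul_eq_mul]
  have hb0 := ne_zero_and_ne_zero_of_mul (fun h => hb' (by rw [h, coeff_zero]) :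
    (b : MvPolynomial (Index n) K) * q b ≠ 0)
  have hdeg : (lexOrder n).degree ((b : MvPolynomial (Index n) K) * q b) = (lexOrder n).degree f :=
    (lexOrder n).toSyn.injective
      (le_antisymm (hq b) ((lexOrder n).le_degree (mem_support_iff.2 hb')))
  refine ⟨b, b.2, ?_⟩
  rw [← hdeg, MonomialOrder.degree_mul hb0.1 hb0.2]
  exact le_self_add

theorem idx_lt_idx_of_lt {i j k l : Fin n} {h : i < j} {h' : k < l} (hik : i < k) :
    idx h < idx h' :=
  lt_of_lend_lt hik

theorem idx_inj {i j k l : Fin n} {h : i < j} {h' : k < l} (he : idx h = idx h') :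
    i = k ∧ j = l :=
  Prod.mk.inj (toLex.injective (congrArg Subtype.val he))

/-! ### The number of generators. -/

variable (K n) in
theorem quadrics_eq_image : quadrics K n =
    (fun φ : Fin 4 → Fin n => quadric K (φ 0) (φ 1) (φ 2) (φ 3)) '' {φ | StrictMono φ} := by
  ext f
  constructor
  · rintro ⟨i, j, k, l, hij, hjk, hkl, rfl⟩
    refine ⟨![i, j, k, l], ?_, rfl⟩
    refine Fin.strictMono_iff_lt_succ.2 fun x => ?_
    fin_cases x <;> assumption
  · rintro ⟨φ, hφ, rfl⟩
    exact ⟨_, _, _, _, hφ (by decide), hφ (by decide), hφ (by decide), rfl⟩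

variable (K n) in
theorem cubics5_eq_image : cubics5 K n =
    (fun φ : Fin 5 → Fin n => cubic5 K (φ 0) (φ 1) (φ 2) (φ 3) (φ 4)) '' {φ | StrictMono φ} := by
  ext f
  constructor
  · rintro ⟨i, j, k, l, m, hij, hjk, hkl, hlm, rfl⟩
    refine ⟨![i, j, k, l, m], ?_, rfl⟩
    refine Fin.strictMono_iff_lt_succ.2 fun x => ?_
    fin_cases x <;> assumption
  · rintro ⟨φ, hφ, rfl⟩
    exact ⟨_, _, _, _, _, hφ (by decide), hφ (by decide), hφ (by decide), hφ (by decide), rfl⟩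

theorem cubicSet_eq_image : cubicSet C =
    (fun φ : Fin 6 → Fin n => C (φ 0) (φ 1) (φ 2) (φ 3) (φ 4) (φ 5)) '' {φ | StrictMono φ} := by
  ext f
  constructor
  · rintro ⟨i, j, k, l, m, s, hij, hjk, hkl, hlm, hms, rfl⟩
    refine ⟨![i, j, k, l, m, s], ?_, rfl⟩
    refine Fin.strictMono_iff_lt_succ.2 fun x => ?_
    fin_cases x <;> assumption
  · rintro ⟨φ, hφ, rfl⟩
    exact ⟨_, _, _, _, _, _, hφ (by decide), hφ (by decide), hφ (by decide), hφ (by decide),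
      hφ (by decide), rfl⟩

variable (K n) in
-- The leading monomial already recovers all indices, which gives injectivity; the cubics are
-- counted in the same way.
theorem ncard_quadrics : (quadrics K n).ncard = n.choose 4 := by
  rw [quadrics_eq_image, Set.InjOn.ncard_image, ncard_strictMono]
  intro φ hφ ψ hψ h
  have lt : ∀ {χ : Fin 4 → Fin n}, StrictMono χ → χ 0 < χ 1 ∧ χ 1 < χ 2 ∧ χ 2 < χ 3 :=
    fun hχ => ⟨hχ (by decide), hχ (by decide), hχ (by decide)⟩
  obtain ⟨h₁, h₂, h₃⟩ := lt hφ
  obtain ⟨h₁', h₂', h₃'⟩ := lt hψ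
  have hd := congrArg (lexOrder n).degree h
  simp only [(quadric_lead K h₁ h₂ h₃).1, (quadric_lead K h₁' h₂' h₃').1] at hd
  obtain ⟨ha, hb⟩ := eq_of_exp₂_le_exp₂ (idx_lt_idx_of_lt (h₁.trans h₂)) (idx_lt_idx_of_lt (h₁'.trans h₂')) hd.le
  have ha := idx_inj ha
  have hb := idx_inj hb
  funext x
  fin_cases x
  exacts [ha.1, ha.2, hb.1, hb.2]

variable (K n) in
theorem ncard_cubics5 : (cubics5 K n).ncard = n.choose 5 := by
  rw [cubics5_eq_image, Set.InjOn.ncard_image, ncard_strictMono]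
  intro φ hφ ψ hψ h
  have lt : ∀ {χ : Fin 5 → Fin n}, StrictMono χ →
      χ 0 < χ 1 ∧ χ 1 < χ 2 ∧ χ 2 < χ 3 ∧ χ 3 < χ 4 :=
    fun hχ => ⟨hχ (by decide), hχ (by decide), hχ (by decide), hχ (by decide)⟩
  obtain ⟨h₁, h₂, h₃, h₄⟩ := lt hφ
  obtain ⟨h₁', h₂', h₃', h₄'⟩ := lt hψ
  have hd := congrArg (lexOrder n).degree h
  simp only [(cubic5_lead K h₁ h₂ h₃ h₄ (h₁.trans h₂) (h₂.trans h₃) (h₃.trans h₄)).1,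
    (cubic5_lead K h₁' h₂' h₃' h₄' (h₁'.trans h₂') (h₂'.trans h₃') (h₃'.trans h₄')).1] at hd
  obtain ⟨ha, hb, hc⟩ := eq_of_exp₃_le_exp₃ (idx_lt_idx_of_lt h₁) (idx_lt_idx_of_lt h₂)
    (idx_lt_idx_of_lt h₁') (idx_lt_idx_of_lt h₂') hd.le
  have ha := idx_inj ha
  have hb := idx_inj hb
  have hc := idx_inj hc
  funext x
  fin_cases x
  exacts [ha.1, hb.1, hc.1, hb.2, hc.2]

theorem ncard_cubicSet (hC : IsCubicFamily C) : (cubicSet C).ncard = n.choose 6 := by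
  rw [cubicSet_eq_image, Set.InjOn.ncard_image, ncard_strictMono]
  intro φ hφ ψ hψ h
  have lt : ∀ {χ : Fin 6 → Fin n}, StrictMono χ →
      χ 0 < χ 1 ∧ χ 1 < χ 2 ∧ χ 2 < χ 3 ∧ χ 3 < χ 4 ∧ χ 4 < χ 5 :=
    fun hχ => ⟨hχ (by decide), hχ (by decide), hχ (by decide), hχ (by decide), hχ (by decide)⟩
  obtain ⟨h₁, h₂, h₃, h₄, h₅⟩ := lt hφ
  obtain ⟨h₁', h₂', h₃', h₄', h₅'⟩ := lt hψ
  have hd := congrArg (lexOrder n).degree h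
  simp only [(hC.lead h₁ h₂ h₃ h₄ h₅ ((h₁.trans h₂).trans h₃) ((h₂.trans h₃).trans h₄)
      ((h₃.trans h₄).trans h₅)).1,
    (hC.lead h₁' h₂' h₃' h₄' h₅' ((h₁'.trans h₂').trans h₃') ((h₂'.trans h₃').trans h₄')
      ((h₃'.trans h₄').trans h₅')).1] at hd
  obtain ⟨ha, hb, hc⟩ := eq_of_exp₃_le_exp₃ (idx_lt_idx_of_lt h₁) (idx_lt_idx_of_lt h₂)
    (idx_lt_idx_of_lt h₁') (idx_lt_idx_of_lt h₂') hd.le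
  have ha := idx_inj ha
  have hb := idx_inj hb
  have hc := idx_inj hc
  funext x
  fin_cases x
  exacts [ha.1, hb.1, hc.1, ha.2, hb.2, hc.2]

variable (K n) in
theorem finite_quadrics : (quadrics K n).Finite := by
  rw [quadrics_eq_image]
  exact (Set.toFinite _).image _

variable (K n) in
theorem finite_cubics5 : (cubics5 K n).Finite := by
  rw [cubics5_eq_image]
  exact (Set.toFinite _).image _

theorem finite_cubicSet : (cubicSet C).Finite := by
  rw [cubicSet_eq_image]
  exact (Set.toFinite _).image _

theorem ncard_generators (hC : IsCubicFamily C) :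
    (generators C).ncard = n.choose 4 + (n.choose 5 + n.choose 6) := by
  have h56 : Disjoint (cubics5 K n) (cubicSet C) := by
    rw [Set.disjoint_left]
    rintro _ ⟨i, j, k, l, m, hij, hjk, hkl, hlm, rfl⟩
      ⟨i', j', k', l', m', s', hij', hjk', hkl', hlm', hms', h⟩
    have hd := congrArg (lexOrder n).degree h
    rw [(cubic5_lead K hij hjk hkl hlm (hij.trans hjk) (hjk.trans hkl) (hkl.trans hlm)).1,
      (hC.lead hij' hjk' hkl' hlm' hms' ((hij'.trans hjk').trans hkl')
        ((hjk'.trans hkl').trans hlm') ((hkl'.trans hlm').trans hms')).1] at hd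
    obtain ⟨ha, -, hc⟩ := eq_of_exp₃_le_exp₃ (idx_lt_idx_of_lt hij) (idx_lt_idx_of_lt hjk)
      (idx_lt_idx_of_lt hij') (idx_lt_idx_of_lt hjk') hd.le
    -- Equal leading monomials would force `k' = l'`, both being equal to `k`.
    exact hkl'.ne ((idx_inj hc).1.symm.trans (idx_inj ha).2)
  have h4 : Disjoint (quadrics K n) (cubics5 K n ∪ cubicSet C) := by
    rw [Set.disjoint_left]
    rintro _ ⟨i, j, k, l, hij, hjk, hkl, rfl⟩ hmem
    have hd := (quadric_lead K hij hjk hkl).1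
    rcases hmem with ⟨i', j', k', l', m', hij', hjk', hkl', hlm', h⟩ |
      ⟨i', j', k', l', m', s', hij', hjk', hkl', hlm', hms', h⟩
    · rw [h, (cubic5_lead K hij' hjk' hkl' hlm' (hij'.trans hjk') (hjk'.trans hkl')
        (hkl'.trans hlm')).1] at hd
      exact not_exp₃_le_exp₂ (idx_lt_idx_of_lt hij') (idx_lt_idx_of_lt hjk') hd.le
    · rw [h, (hC.lead hij' hjk' hkl' hlm' hms' ((hij'.trans hjk').trans hkl')
        ((hjk'.trans hkl').trans hlm') ((hkl'.trans hlm').trans hms')).1] at hd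
      exact not_exp₃_le_exp₂ (idx_lt_idx_of_lt hij') (idx_lt_idx_of_lt hjk') hd.le
  rw [generators, Set.ncard_union_eq h4 (finite_quadrics K n)
    ((finite_cubics5 K n).union finite_cubicSet),
    Set.ncard_union_eq h56 (finite_cubics5 K n) finite_cubicSet, ncard_quadrics, ncard_cubics5,
    ncard_cubicSet hC]

/-! ### The Gröbner, minimality and reducedness statements. -/

theorem isGroebnerBasis_generators (hC : IsCubicFamily C) :
    GroebnerBasis.IsGroebnerBasis (lexOrder n) (pluckerIdeal K n) (generators C) := by
  refine ⟨(finite_quadrics K n).union ((finite_cubics5 K n).union finite_cubicSet),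
    generators_subset hC, fun g hg h0 => ?_, le_antisymm (Ideal.span_le.2 ?_)
    (Ideal.span_mono (Set.image_mono (generators_subset hC)))⟩
  · have := leadingCoeff_of_mem hC hg
    rw [h0, MonomialOrder.leadingCoeff_zero] at this
    exact zero_ne_one this
  · rintro _ ⟨f, hf, rfl⟩
    by_cases hf0 : f = 0
    · rw [hf0, MonomialOrder.leadingTerm_zero]
      exact zero_mem _
    · obtain ⟨g, hg, hle⟩ := exists_degree_le hC hf hf0
      have h : (lexOrder n).leadingTerm f =
          monomial ((lexOrder n).degree f - (lexOrder n).degree g) ((lexOrder n).leadingCoeff f) *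
            (lexOrder n).leadingTerm g := by
        rw [MonomialOrder.leadingTerm, MonomialOrder.leadingTerm, monomial_mul,
          leadingCoeff_of_mem hC hg, mul_one, tsub_add_cancel_of_le hle]
      rw [h]
      exact Ideal.mul_mem_left _ _ (Ideal.subset_span ⟨g, hg, rfl⟩)

theorem isMinimalGroebnerBasis_generators (hC : IsCubicFamily C) :
    GroebnerBasis.IsMinimalGroebnerBasis (lexOrder n) (pluckerIdeal K n) (generators C) :=
  ⟨isGroebnerBasis_generators hC, fun _ hg => leadingCoeff_of_mem hC hg,
    fun _ hg _ hh hne hle => hne (eq_of_degree_le hC hg hh hle)⟩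

variable (K n) in
/-- All nonleading monomials of the reduced generators are standard. -/
theorem eq_degree_or_isStandard {g : MvPolynomial (Index n) K} (hg : g ∈ generators (cubic6' K))
    {d : Index n →₀ ℕ} (hd : d ∈ g.support) : d = (lexOrder n).degree g ∨ IsStandard d := by
  rcases hg with ⟨i, j, k, l, hij, hjk, hkl, rfl⟩ | ⟨i, j, k, l, m, hij, hjk, hkl, hlm, rfl⟩ |
    ⟨i, j, k, l, m, s, hij, hjk, hkl, hlm, hms, rfl⟩
  · obtain ⟨r, h, hr⟩ := quadric_eq K hij hjk hkl
    rw [(quadric_lead K hij hjk hkl).1]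
    rw [h] at hd
    exact (mem_support_add hd).imp mem_support_monomial fun h => (hr d h).2
  · have hik := hij.trans hjk
    have hjl := hjk.trans hkl
    have hkm := hkl.trans hlm
    obtain ⟨r, h, hr⟩ := cubic5_eq K hij hjk hkl hlm hik hjl hkm
    rw [(cubic5_lead K hij hjk hkl hlm hik hjl hkm).1]
    rw [h] at hd
    exact (mem_support_add hd).imp mem_support_monomial fun h => (hr d h).2
  · have hil := (hij.trans hjk).trans hkl
    have hjm := (hjk.trans hkl).trans hlm
    have hks := (hkl.trans hlm).trans hms
    obtain ⟨r, h, hr⟩ := cubic6'_eq K hij hjk hkl hlm hms hil hjm hks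
    rw [((isCubicFamily_cubic6' K).lead hij hjk hkl hlm hms hil hjm hks).1]
    rw [h] at hd
    exact (mem_support_add hd).imp mem_support_monomial fun h => (hr d h).2

variable (K n) in
theorem isReducedGroebnerBasis_generators :
    GroebnerBasis.IsReducedGroebnerBasis (lexOrder n) (pluckerIdeal K n)
      (generators (cubic6' K)) := by
  have hC := isCubicFamily_cubic6' K (n := n)
  refine ⟨isGroebnerBasis_generators hC, fun _ hg => leadingCoeff_of_mem hC hg,
    fun g hg h hh hne d hd hle => ?_⟩
  rcases eq_degree_or_isStandard K n hg hd with rfl | hstd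
  · exact hne (eq_of_degree_le hC hg hh hle)
  · exact hstd.not_degree_le hC hh hle

variable (K) in
theorem leadingTerm_quadric {i j k l : Fin n} (hij : i < j) (hjk : j < k) (hkl : k < l) :
    (lexOrder n).leadingTerm (quadric K i j k l) = p K i j * p K k l := by
  rw [MonomialOrder.leadingTerm, (quadric_lead K hij hjk hkl).1, (quadric_lead K hij hjk hkl).2,
    p_eq K hij, p_eq K hkl, X_mul_X]

variable (K) in
theorem leadingTerm_cubic5 {i j k l m : Fin n} (hij : i < j) (hjk : j < k) (hkl : k < l)
    (hlm : l < m) :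
    (lexOrder n).leadingTerm (cubic5 K i j k l m) = p K i k * p K j l * p K k m := by
  obtain ⟨hd, hc⟩ := cubic5_lead K hij hjk hkl hlm (hij.trans hjk) (hjk.trans hkl) (hkl.trans hlm)
  rw [MonomialOrder.leadingTerm, hd, hc, p_eq K (hij.trans hjk), p_eq K (hjk.trans hkl),
    p_eq K (hkl.trans hlm), X_mul_X_mul_X]

theorem IsCubicFamily.leadingTerm (hC : IsCubicFamily C) {i j k l m s : Fin n} (hij : i < j)
    (hjk : j < k) (hkl : k < l) (hlm : l < m) (hms : m < s) :
    (lexOrder n).leadingTerm (C i j k l m s) = p K i l * p K j m * p K k s := by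
  have hil := (hij.trans hjk).trans hkl
  have hjm := (hjk.trans hkl).trans hlm
  have hks := (hkl.trans hlm).trans hms
  obtain ⟨hd, hc⟩ := hC.lead hij hjk hkl hlm hms hil hjm hks
  rw [MonomialOrder.leadingTerm, hd, hc, p_eq K hil, p_eq K hjm, p_eq K hks, X_mul_X_mul_X]

end Generators

end Plucker

theorem mainTheorem7 (K : Type*) [Field K] (n : ℕ) :
    -- the listed quadrics and cubics form a minimal lexicographic Gröbner basis
    GroebnerBasis.IsMinimalGroebnerBasis (Plucker.lexOrder n) (Plucker.pluckerIdeal K n)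
      (Plucker.quadrics K n ∪ (Plucker.cubics5 K n ∪ Plucker.cubics6 K n)) ∧
    -- their leading terms
    (∀ i j k l : Fin n, i < j → j < k → k < l →
      (Plucker.lexOrder n).leadingTerm (Plucker.quadric K i j k l) =
        Plucker.p K i j * Plucker.p K k l) ∧
    (∀ i j k l m : Fin n, i < j → j < k → k < l → l < m →
      (Plucker.lexOrder n).leadingTerm (Plucker.cubic5 K i j k l m) =
        Plucker.p K i k * Plucker.p K j l * Plucker.p K k m) ∧
    (∀ i j k l m s : Fin n, i < j → j < k → k < l → l < m → m < s →
      (Plucker.lexOrder n).leadingTerm (Plucker.cubic6 K i j k l m s) =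
        Plucker.p K i l * Plucker.p K j m * Plucker.p K k s) ∧
    -- their number
    (Plucker.quadrics K n).ncard = n.choose 4 ∧
    (Plucker.cubics5 K n).ncard = n.choose 5 ∧
    (Plucker.cubics6 K n).ncard = n.choose 6 ∧
    (Plucker.quadrics K n ∪ (Plucker.cubics5 K n ∪ Plucker.cubics6 K n)).ncard =
      n.choose 4 + (n.choose 5 + n.choose 6) ∧
    -- after the two tail reductions in each six-index cubic, the Gröbner basis is reduced
    (∀ i j k l m s : Fin n, i < j → j < k → k < l → l < m → m < s →
      Plucker.cubic6' K i j k l m s =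
        Plucker.cubic6 K i j k l m s + Plucker.p K i m * Plucker.quadric K j k l s
          - Plucker.p K i s * Plucker.quadric K j k l m ∧
      (Plucker.lexOrder n).leadingTerm (Plucker.cubic6' K i j k l m s) =
        Plucker.p K i l * Plucker.p K j m * Plucker.p K k s) ∧
    (Plucker.cubics6' K n).ncard = n.choose 6 ∧
    (Plucker.quadrics K n ∪ (Plucker.cubics5 K n ∪ Plucker.cubics6' K n)).ncard =
      n.choose 4 + (n.choose 5 + n.choose 6) ∧
    GroebnerBasis.IsReducedGroebnerBasis (Plucker.lexOrder n) (Plucker.pluckerIdeal K n)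
      (Plucker.quadrics K n ∪ (Plucker.cubics5 K n ∪ Plucker.cubics6' K n)) := by
  have hC := Plucker.isCubicFamily_cubic6 K (n := n)
  have hC' := Plucker.isCubicFamily_cubic6' K (n := n)
  -- `generators` at the two families unfolds definitionally to the displayed unions.
  exact ⟨Plucker.isMinimalGroebnerBasis_generators hC,
    fun _ _ _ _ => Plucker.leadingTerm_quadric K, fun _ _ _ _ _ => Plucker.leadingTerm_cubic5 K,
    fun _ _ _ _ _ _ => hC.leadingTerm, Plucker.ncard_quadrics K n, Plucker.ncard_cubics5 K n,
    Plucker.ncard_cubicSet hC, Plucker.ncard_generators hC,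
    fun i j k l m s hij hjk hkl hlm hms =>
      ⟨Plucker.cubic6'_eq_cubic6_add K i j k l m s, hC'.leadingTerm hij hjk hkl hlm hms⟩,
    Plucker.ncard_cubicSet hC', Plucker.ncard_generators hC',
    Plucker.isReducedGroebnerBasis_generators K n⟩
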